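/- **Theorem.** Let $r\ge 1$ be an integer. There is a constant $C=C(r)>0$, and for every $\kappa>0$ there are constants $c>0$ and $c'>0$ depending only on $r$ and $\kappa$, such that the following holds for all $\alpha\in(0,1)$ and all integers $m,k\ge 1$. Let $\Phi$ be an $m\times k$ random matrix with independent real entries of mean zero and unit variance which are sub-Gaussian with parameter $\kappa$, that is, $\mathbb P(|\Phi_{ij}|>t)\le e^{1-\kappa t^2}$ for all $t\ge 0$. Let $D$ be the $m\times m$ lower bidiagonal matrix with diagonal entries $1$ and subdiagonal entries $-1$. If $$\lambda:=\frac mk\ \ge\ c^{\frac1{1-\alpha}},$$ then with probability at least $1-\exp(-c' m\lambda^{-\alpha})$ both of the following hold. 1. The smallest singular value satisfies $\displaystyle \sigma_{\min}(D^{-r}\Phi)\ \ge\ \lambda^{\alpha(r-\frac12)}\sqrt m .$ 2. For all $x\in\mathbb R^k$ and $q,u\in\mathbb R^m$ with $\Phi x-q=D^r u$ (that is, $q$ is an $r$-th order $\Sigma\Delta$ quantization of $\Phi x$ with state vector $u$), reconstruction with the $r$-th order Sobolev dual $\Psi_{D^{-r}}:=(D^{-r}\Phi)^\dagger D^{-r}$,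 where $A^\dagger:=(A^*A)^{-1}A^*$, has the error bound $$\|x-\Psi_{D^{-r}}q\|_2\ \le\ C\,\lambda^{-\alpha(r-\frac12)}\,\|u\|_\infty .$$ -/

import Mathlib

open MeasureTheory ProbabilityTheory

noncomputable section

/-- A real random variable `ξ` is sub-Gaussian with parameter `κ > 0` if
`ℙ(|ξ| > t) ≤ exp (1 - κ t²)` for all `t ≥ 0`. -/
def IsSubGaussianWith {Ω : Type*} [MeasurableSpace Ω] (ξ : Ω → ℝ) (κ : ℝ) (P : Measure Ω) :
    Prop :=
  0 < κ ∧ ∀ t : ℝ, 0 ≤ t → P.real {ω | t < |ξ ω|} ≤ Real.exp (1 - κ * t ^ 2)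

/-- The lower bidiagonal `m × m` difference matrix `D`: ones on the diagonal, `-1` on the
subdiagonal. -/
def diffMatrix (m : ℕ) : Matrix (Fin m) (Fin m) ℝ :=
  Matrix.of fun i j => if i = j then 1 else if (i : ℕ) = (j : ℕ) + 1 then -1 else 0

/-- `D` has determinant one, so `D ^ r` is invertible and `(D ^ r)⁻¹` is its genuine inverse. -/
theorem det_diffMatrix (m : ℕ) : (diffMatrix m).det = 1 := by
  rw [Matrix.det_of_isLowerTriangular]
  · simp [diffMatrix]
  · intro i j hij
    have h : i < j := by simpa using hij
    have h1 : i ≠ j := h.ne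
    have h2 : (i : ℕ) ≠ (j : ℕ) + 1 := by
      have : (i : ℕ) < (j : ℕ) := h
      omega
    simp [diffMatrix, h1, h2]

/-- The smallest singular value `σ_min(A)` of an `m × k` matrix, i.e. the `k`-th largest singular
value of `A : ℝᵏ → ℝᵐ` with Euclidean norms (Mathlib's singular values are decreasing and indexed
from zero). -/
def sigmaMin {m k : ℕ} (A : Matrix (Fin m) (Fin k) ℝ) : ℝ :=
  (Matrix.toEuclideanLin A).singularValues (k - 1)

/-- The canonical dual `A† = (A* A)⁻¹ A*` of a frame with analysis matrix `A`. -/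
def canonicalDual {m k : ℕ} (A : Matrix (Fin m) (Fin k) ℝ) : Matrix (Fin k) (Fin m) ℝ :=
  (A.transpose * A)⁻¹ * A.transpose

/-- The `V`-dual `(V Φ)† V` of the frame `Φ`. -/
def vDual {p m k : ℕ} (V : Matrix (Fin p) (Fin m) ℝ) (Φ : Matrix (Fin m) (Fin k) ℝ) :
    Matrix (Fin k) (Fin m) ℝ :=
  canonicalDual (V * Φ) * V

/-- The `r`-th order Sobolev dual of `Φ`, i.e. its `D⁻ʳ`-dual. -/
def sobolevDual {m k : ℕ} (r : ℕ) (Φ : Matrix (Fin m) (Fin k) ℝ) : Matrix (Fin k) (Fin m) ℝ :=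
  vDual (diffMatrix m ^ r)⁻¹ Φ

/-- The Euclidean norm of a coordinate vector. -/
def l2norm {n : ℕ} (v : Fin n → ℝ) : ℝ :=
  ‖WithLp.toLp 2 v‖

end

/-!
The smallest singular value of `D⁻ʳ Φ` is bounded below by duality against smooth test vectors. If
`y = Φ x` and `z = D⁻ʳ y`, then `⟪y, w⟫ = ⟪z, (Dᵀ) ^ r w⟫` for every `w`, so `z` must be large as soon
as `y` correlates with vectors `w` on which the difference operator `(Dᵀ) ^ r` is small. As test
vectors serve `l` normalised discrete B-splines at scale `h`, placed in consecutive disjoint blocks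
of `{1, …, m}`: they satisfy `‖(Dᵀ) ^ r w‖ ≤ C h ^ (-r)`, and both `w` and `(Dᵀ) ^ r w` stay in the
block (`exists_smooth_testVectors`). Hence `‖D⁻ʳ Φ x‖ ≥ C⁻¹ h ^ r ‖W Φ x‖`, where `W` is the `l × m`
matrix whose rows are the test vectors.

Since the rows of `W` are unit vectors with disjoint supports, for a fixed unit vector `x` the `l`
entries of `W Φ x` are independent, centred, of variance one and sub-Gaussian. Chernoff bounds
show that `‖W Φ x‖²` lies between `l / 4` and a constant times `l`, up to probability `exp (-γ l)`
(`measureReal_sum_sq_le`, `measureReal_le_sum_sq`). A net of the sphere of `ℝᵏ` at a constant scale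
has `exp (O (k))` points, so that the smallest singular value of `W Φ` is at least `√l / 4` once `l`
is a large multiple of `k` (`measureReal_compression_lowerBound`).

With `h ≈ A λ ^ α` and `l ≈ m / ((r + 1) h)`, the number `l` is comparable to
`m λ ^ (-α) = k λ ^ (1 - α)`, which exceeds any prescribed multiple of `k` under the assumption on
`λ`, and `h ^ r √l` is at least `A ^ (r - 1 / 2) λ ^ (α (r - 1 / 2)) √m` up to a constant depending on
`r`. Since `r ≥ 1`, a large `A` absorbs every constant (`exists_block_parameters`).

The reconstruction error is `(D⁻ʳ Φ)† u`, whose norm is at most `‖u‖₂ / σ_min ≤ √m ‖u‖_∞ / σ_min`; the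
error bound therefore holds with `C = 1`.
-/

/-! ### Smooth test vectors for the difference operator -/

section TestVectors

open Polynomial

/-- The vector of length `m` whose entries are the coefficients of `p` in reversed order; coefficients
of degree at least `m` are discarded. -/
noncomputable def revCoeff (m : ℕ) (p : ℝ[X]) : Fin m → ℝ := fun i => p.coeff (m - 1 - i)

/-- In reversed coefficient order the forward difference `Dᵀ` is multiplication by `1 - X`. -/
theorem transpose_diffMatrix_mulVec_revCoeff (m : ℕ) (p : ℝ[X]) :
    (diffMatrix m).transpose.mulVec (revCoeff m p) = revCoeff m ((1 - X) * p) := by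
  funext i
  have hterm : ∀ j, (diffMatrix m).transpose i j * revCoeff m p j
      = (if j = i then revCoeff m p j else 0)
        - (if (j : ℕ) = i + 1 then revCoeff m p j else 0) := by
    intro j
    simp only [diffMatrix, Matrix.transpose_apply, Matrix.of_apply]
    by_cases h1 : j = i
    · subst h1; simp
    · by_cases h2 : (j : ℕ) = i + 1 <;> simp [h1, h2]
  simp only [Matrix.mulVec, dotProduct]
  rw [Finset.sum_congr rfl fun j _ => hterm j, Finset.sum_sub_distrib]
  simp only [Finset.sum_ite_eq', Finset.mem_univ, if_true]
  have hi := i.isLt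
  rw [sub_mul, one_mul]
  by_cases h : (i : ℕ) + 1 < m
  · have : ∑ j : Fin m, (if (j : ℕ) = i + 1 then revCoeff m p j else 0)
        = revCoeff m p ⟨i + 1, h⟩ := by
      rw [Finset.sum_eq_single (⟨i + 1, h⟩ : Fin m)]
      · simp
      · intro j _ hj
        rw [if_neg]
        exact fun h' => hj (Fin.ext h')
      · simp
    rw [this]
    simp only [revCoeff, coeff_sub]
    have e : m - 1 - (i : ℕ) = (m - 1 - (i + 1)) + 1 := by omega
    rw [e, coeff_X_mul]
  · have : ∑ j : Fin m, (if (j : ℕ) = i + 1 then revCoeff m p j else 0) = 0 := by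
      refine Finset.sum_eq_zero fun j _ => if_neg ?_
      have := j.isLt
      omega
    rw [this]
    have e : m - 1 - (i : ℕ) = 0 := by omega
    simp [revCoeff, e]

theorem transpose_diffMatrix_pow_mulVec_revCoeff (m r : ℕ) (p : ℝ[X]) :
    ((diffMatrix m ^ r).transpose).mulVec (revCoeff m p) = revCoeff m ((1 - X) ^ r * p) := by
  induction r generalizing p with
  | zero => simp
  | succ r ih =>
    rw [pow_succ, Matrix.transpose_mul, ← Matrix.mulVec_mulVec, ih,
      transpose_diffMatrix_mulVec_revCoeff, pow_succ' (1 - X : ℝ[X]), mul_assoc]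

/-- The sum of the squares of the coefficients in degrees below `n`. -/
noncomputable def coeffSq (n : ℕ) (p : ℝ[X]) : ℝ := ∑ i ∈ Finset.range n, p.coeff i ^ 2

theorem coeffSq_eq_of_natDegree_lt {n n' : ℕ} {p : ℝ[X]} (h : p.natDegree < n) (hn : n ≤ n') :
    coeffSq n' p = coeffSq n p := by
  refine (Finset.sum_subset (Finset.range_subset_range.2 hn) fun i _ hi => ?_).symm
  rw [coeff_eq_zero_of_natDegree_lt, sq, zero_mul]
  simp only [Finset.mem_range, not_lt] at hi
  omega

/-- Multiplication by `1 - X ^ h` at most quadruples the sum of squares of the coefficients. -/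
theorem coeffSq_one_sub_X_pow_mul_le (n h : ℕ) (p : ℝ[X]) :
    coeffSq n ((1 - X ^ h) * p) ≤ 4 * coeffSq n p := by
  have hshift : ∑ i ∈ Finset.range n, (X ^ h * p).coeff i ^ 2 ≤ coeffSq n p := by
    calc ∑ i ∈ Finset.range n, (X ^ h * p).coeff i ^ 2
        ≤ ∑ i ∈ Finset.range (h + n), (X ^ h * p).coeff i ^ 2 :=
          Finset.sum_le_sum_of_subset_of_nonneg (Finset.range_subset_range.2 (by omega))
            fun i _ _ => sq_nonneg _
      _ = coeffSq n p := by
          rw [Finset.sum_range_add]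
          have h0 : ∑ i ∈ Finset.range h, (X ^ h * p).coeff i ^ 2 = 0 := by
            refine Finset.sum_eq_zero fun i hi => ?_
            rw [coeff_X_pow_mul', if_neg (by simpa using hi)]
            simp
          rw [h0, zero_add]
          refine Finset.sum_congr rfl fun i _ => ?_
          rw [add_comm, coeff_X_pow_mul]
  calc coeffSq n ((1 - X ^ h) * p)
      = ∑ i ∈ Finset.range n, (p.coeff i - (X ^ h * p).coeff i) ^ 2 := by
        simp [coeffSq, sub_mul]
    _ ≤ ∑ i ∈ Finset.range n, (2 * p.coeff i ^ 2 + 2 * (X ^ h * p).coeff i ^ 2) := by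
        refine Finset.sum_le_sum fun i _ => ?_
        nlinarith [sq_nonneg (p.coeff i + (X ^ h * p).coeff i)]
    _ = 2 * coeffSq n p + 2 * ∑ i ∈ Finset.range n, (X ^ h * p).coeff i ^ 2 := by
        rw [Finset.sum_add_distrib, ← Finset.mul_sum, ← Finset.mul_sum]; rfl
    _ ≤ _ := by linarith

theorem coeffSq_one_sub_X_pow_pow_mul_le (n h r : ℕ) (p : ℝ[X]) :
    coeffSq n ((1 - X ^ h) ^ r * p) ≤ 4 ^ r * coeffSq n p := by
  induction r with
  | zero => simp
  | succ r ih =>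
    rw [pow_succ', mul_assoc, pow_succ' (4 : ℝ), mul_assoc]
    exact (coeffSq_one_sub_X_pow_mul_le n h _).trans (by linarith)

/-- The polynomial `1 + X + ⋯ + X ^ (h - 1)`, the discrete box of length `h`. Its powers are discrete
B-splines. -/
noncomputable def geomPoly (h : ℕ) : ℝ[X] := ∑ i ∈ Finset.range h, X ^ i

theorem one_sub_X_mul_geomPoly (h : ℕ) : (1 - X) * geomPoly h = 1 - X ^ h :=
  mul_neg_geom_sum X h

theorem coeff_geomPoly (h n : ℕ) : (geomPoly h).coeff n = if n < h then 1 else 0 := by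
  simp [geomPoly, coeff_X_pow]

theorem natDegree_geomPoly_le (h : ℕ) : (geomPoly h).natDegree ≤ h - 1 := by
  rw [natDegree_le_iff_coeff_eq_zero]
  intro n hn
  rw [coeff_geomPoly, if_neg (by omega)]

theorem natDegree_geomPoly_pow_lt {h : ℕ} (hh : 0 < h) (r : ℕ) :
    (geomPoly h ^ (r + 1)).natDegree < (r + 1) * h := by
  refine lt_of_le_of_lt
    (natDegree_pow_le.trans (Nat.mul_le_mul_left _ (natDegree_geomPoly_le h))) ?_
  exact Nat.mul_lt_mul_of_pos_left (by omega) (by omega)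

theorem coeffSq_geomPoly_le (n h : ℕ) : coeffSq n (geomPoly h) ≤ h := by
  calc coeffSq n (geomPoly h) ≤ coeffSq (max n h) (geomPoly h) :=
        Finset.sum_le_sum_of_subset_of_nonneg (Finset.range_subset_range.2 (le_max_left _ _))
          fun i _ _ => sq_nonneg _
    _ = ∑ i ∈ Finset.range (max n h), if i < h then (1 : ℝ) else 0 := by
        refine Finset.sum_congr rfl fun i _ => ?_
        rw [coeff_geomPoly]; split_ifs <;> norm_num
    _ = ((Finset.range (max n h)).filter (· < h)).card := by simp
    _ ≤ h := by
        have : (Finset.range (max n h)).filter (· < h) ⊆ Finset.range h := fun i hi => by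
          simpa using (Finset.mem_filter.1 hi).2
        exact_mod_cast (Finset.card_le_card this).trans_eq (Finset.card_range h)

/-- By Cauchy-Schwarz, the coefficients of a B-spline, which sum to `h ^ (r + 1)` over at most
`(r + 1) h` degrees, have large sum of squares. -/
theorem le_coeffSq_geomPoly_pow {h : ℕ} (hh : 0 < h) (r : ℕ) :
    (h : ℝ) * h ^ (2 * r) ≤ (r + 1) * coeffSq ((r + 1) * h) (geomPoly h ^ (r + 1)) := by
  have hsum : ∑ i ∈ Finset.range ((r + 1) * h), (geomPoly h ^ (r + 1)).coeff i
      = (h : ℝ) ^ (r + 1) := by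
    have h1 := eval_eq_sum_range' (natDegree_geomPoly_pow_lt hh r) (1 : ℝ)
    simp only [one_pow, mul_one] at h1
    rw [← h1, eval_pow]
    simp [geomPoly, eval_finsetSum]
  have hcs := sq_sum_le_card_mul_sum_sq (s := Finset.range ((r + 1) * h))
    (f := fun i => (geomPoly h ^ (r + 1)).coeff i)
  rw [hsum, Finset.card_range] at hcs
  push_cast at hcs
  have hh' : (0 : ℝ) < h := by exact_mod_cast hh
  refine le_of_mul_le_mul_left ?_ hh'
  calc (h : ℝ) * (h * h ^ (2 * r)) = (h ^ (r + 1)) ^ 2 := by ring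
    _ ≤ _ := hcs
    _ = _ := by unfold coeffSq; ring

/-- A polynomial placed in the `b`-th block of length `n` keeps its sum of squares. -/
theorem sum_sq_revCoeff_block {m n b : ℕ} {p : ℝ[X]} (hp : p.natDegree < n)
    (hb : (b + 1) * n ≤ m) :
    ∑ i, revCoeff m (X ^ (b * n) * p) i ^ 2 = coeffSq n p := by
  have h1 : ∑ i, revCoeff m (X ^ (b * n) * p) i ^ 2
      = ∑ i ∈ Finset.range m, (X ^ (b * n) * p).coeff i ^ 2 := by
    exact (Fin.sum_univ_eq_sum_range (fun i => (X ^ (b * n) * p).coeff (m - 1 - i) ^ 2) m).trans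
      (Finset.sum_range_reflect (fun i => (X ^ (b * n) * p).coeff i ^ 2) m)
  obtain ⟨d, rfl⟩ : ∃ d, m = b * n + d := ⟨m - b * n, by
    have : b * n ≤ m := le_trans (Nat.mul_le_mul_right _ (by omega)) hb
    omega⟩
  have hd : n ≤ d := by
    have : (b + 1) * n = b * n + n := by ring
    omega
  rw [h1, Finset.sum_range_add, Finset.sum_eq_zero, zero_add, ← coeffSq_eq_of_natDegree_lt hp hd]
  · refine Finset.sum_congr rfl fun i _ => ?_
    rw [add_comm, coeff_X_pow_mul]
  · intro i hi
    rw [coeff_X_pow_mul', if_neg (by simpa using hi)]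
    simp

theorem block_eq_of_revCoeff_ne_zero {m n b : ℕ} {p : ℝ[X]} (hp : p.natDegree < n) {i : Fin m}
    (hi : revCoeff m (X ^ (b * n) * p) i ≠ 0) : (m - 1 - (i : ℕ)) / n = b := by
  rw [revCoeff, coeff_X_pow_mul'] at hi
  split_ifs at hi with h
  · have h2 : m - 1 - (i : ℕ) - b * n ≤ p.natDegree := le_natDegree_of_ne_zero hi
    refine Nat.div_eq_of_lt_le h ?_
    have : (b + 1) * n = b * n + n := by ring
    omega
  · exact absurd rfl hi

/-- Bessel-type inequality for vectors with disjoint supports. -/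
theorem sum_sq_dotProduct_le_of_disjoint {m l : ℕ} (idx : Fin m → ℕ) (v : Fin l → Fin m → ℝ)
    (hv : ∀ b i, v b i ≠ 0 → idx i = b) {M : ℝ} (hM : 0 ≤ M) (hvM : ∀ b, ∑ i, v b i ^ 2 ≤ M)
    (z : Fin m → ℝ) :
    ∑ b, (∑ i, v b i * z i) ^ 2 ≤ M * ∑ i, z i ^ 2 := by
  have hone : ∀ b : Fin l, (∑ i, v b i * z i) ^ 2 ≤
      M * ∑ i, if idx i = b then z i ^ 2 else 0 := by
    intro b
    have e : ∑ i, v b i * z i = ∑ i, v b i * (if idx i = b then z i else 0) := by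
      refine Finset.sum_congr rfl fun i _ => ?_
      by_cases h : v b i = 0
      · simp [h]
      · simp [hv b i h]
    have e2 : ∀ i, (if idx i = b then z i else 0) ^ 2 = if idx i = b then z i ^ 2 else 0 := by
      intro i; split_ifs <;> simp
    rw [e]
    refine (Finset.sum_mul_sq_le_sq_mul_sq _ _ _).trans ?_
    simp only [e2]
    refine mul_le_mul_of_nonneg_right (hvM b) (Finset.sum_nonneg fun i _ => ?_)
    split_ifs <;> positivity
  calc ∑ b, (∑ i, v b i * z i) ^ 2
      ≤ ∑ b : Fin l, M * ∑ i, (if idx i = b then z i ^ 2 else 0) :=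
        Finset.sum_le_sum fun b _ => hone b
    _ = M * ∑ i, ∑ b : Fin l, (if idx i = b then z i ^ 2 else 0) := by
        rw [← Finset.mul_sum, Finset.sum_comm]
    _ ≤ M * ∑ i, z i ^ 2 := by
        refine mul_le_mul_of_nonneg_left (Finset.sum_le_sum fun i _ => ?_) hM
        by_cases h : idx i < l
        · rw [Finset.sum_eq_single (⟨idx i, h⟩ : Fin l)]
          · simp
          · intro b _ hb
            rw [if_neg]
            exact fun h' => hb (Fin.ext h'.symm)
          · simp
        · rw [Finset.sum_eq_zero]
          · positivity
          · intro b _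
            rw [if_neg]
            have := b.isLt
            omega

/-- Smooth test vectors: `l` unit vectors with disjoint supports on which `(Dᵀ) ^ r` is as small
as `h ^ (-r)`, up to a constant depending on `r`. They are normalised B-splines of order `r + 1`
placed in consecutive blocks. -/
theorem exists_smooth_testVectors (r : ℕ) {h l m : ℕ} (hh : 0 < h) (hl : l * ((r + 1) * h) ≤ m) :
    ∃ (w : Fin l → Fin m → ℝ) (idx : Fin m → ℕ), (∀ b i, w b i ≠ 0 → idx i = b) ∧
      (∀ b, ∑ i, w b i ^ 2 = 1) ∧
      ∀ z : Fin m → ℝ, (h : ℝ) ^ (2 * r) * ∑ b, (∑ i, w b i * (diffMatrix m ^ r).mulVec z i) ^ 2 ≤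
        4 ^ r * (r + 1) * ∑ i, z i ^ 2 := by
  set n := (r + 1) * h with hn
  set p : ℝ[X] := geomPoly h ^ (r + 1) with hp
  have hdeg : p.natDegree < n := natDegree_geomPoly_pow_lt hh r
  have hh' : (0 : ℝ) < h := by exact_mod_cast hh
  have hlow := le_coeffSq_geomPoly_pow hh r
  rw [← hn, ← hp] at hlow
  set N := coeffSq n p with hN
  have hNpos : 0 < N := by
    have h1 : (0 : ℝ) < h * h ^ (2 * r) := by positivity
    have h2 : 0 < (r + 1 : ℝ) * N := h1.trans_le hlow
    exact (mul_pos_iff_of_pos_left (by positivity)).1 h2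
  set q : ℝ[X] := (1 - X ^ h) ^ r * geomPoly h with hq
  -- Differencing `r` of the `r + 1` box factors leaves `r` jumps of step `h` and one box.
  have hqp : (1 - X) ^ r * p = q := by
    rw [hp, hq, pow_succ, ← mul_assoc, ← mul_pow, one_sub_X_mul_geomPoly]
  have hqdeg : q.natDegree < n := by
    have h1 : ((1 - X ^ h : ℝ[X]) ^ r).natDegree ≤ r * h := by
      refine natDegree_pow_le.trans (Nat.mul_le_mul_left _ ?_)
      refine (natDegree_sub_le _ _).trans ?_
      simp
    have h2 := natDegree_mul_le (p := (1 - X ^ h : ℝ[X]) ^ r) (q := geomPoly h)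
    rw [← hq] at h2
    have h3 := natDegree_geomPoly_le h
    have h4 : n = r * h + h := by rw [hn]; ring
    omega
  have hblock : ∀ b : Fin l, ((b : ℕ) + 1) * n ≤ m := fun b =>
    (Nat.mul_le_mul_right _ b.isLt).trans hl
  refine ⟨fun b i => (Real.sqrt N)⁻¹ * revCoeff m (X ^ ((b : ℕ) * n) * p) i,
    fun i => (m - 1 - (i : ℕ)) / n, fun b i hne => ?_, fun b => ?_, fun z => ?_⟩
  · exact block_eq_of_revCoeff_ne_zero hdeg (right_ne_zero_of_mul hne)
  · simp only [mul_pow]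
    rw [← Finset.mul_sum, sum_sq_revCoeff_block hdeg (hblock b), inv_pow, Real.sq_sqrt hNpos.le,
      inv_mul_cancel₀ hNpos.ne']
  · have hdual : ∀ b : Fin l,
        ∑ i, (Real.sqrt N)⁻¹ * revCoeff m (X ^ ((b : ℕ) * n) * p) i
            * (diffMatrix m ^ r).mulVec z i
          = (Real.sqrt N)⁻¹ * ∑ i, revCoeff m (X ^ ((b : ℕ) * n) * q) i * z i := by
      intro b
      have h1 : (1 - X) ^ r * (X ^ ((b : ℕ) * n) * p) = X ^ ((b : ℕ) * n) * q := by
        rw [← hqp]; ring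
      rw [← h1, ← transpose_diffMatrix_pow_mulVec_revCoeff]
      simp only [mul_assoc]
      rw [← Finset.mul_sum]
      congr 1
      change revCoeff m (X ^ ((b : ℕ) * n) * p) ⬝ᵥ (diffMatrix m ^ r).mulVec z
        = ((diffMatrix m ^ r).transpose).mulVec (revCoeff m (X ^ ((b : ℕ) * n) * p)) ⬝ᵥ z
      rw [Matrix.dotProduct_mulVec, Matrix.mulVec_transpose]
    have hM : ∀ b : Fin l, ∑ i, revCoeff m (X ^ ((b : ℕ) * n) * q) i ^ 2 ≤ 4 ^ r * h := by
      intro b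
      rw [sum_sq_revCoeff_block hqdeg (hblock b)]
      refine (coeffSq_one_sub_X_pow_pow_mul_le n h r _).trans ?_
      exact mul_le_mul_of_nonneg_left (coeffSq_geomPoly_le n h) (by positivity)
    have hbessel := sum_sq_dotProduct_le_of_disjoint (fun i : Fin m => (m - 1 - (i : ℕ)) / n)
      (fun (b : Fin l) i => revCoeff m (X ^ ((b : ℕ) * n) * q) i)
      (fun b i hne => block_eq_of_revCoeff_ne_zero hqdeg hne) (by positivity) hM z
    simp only [hdual, mul_pow, inv_pow, Real.sq_sqrt hNpos.le]
    rw [← Finset.mul_sum]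
    have hz : 0 ≤ ∑ i, z i ^ 2 := Finset.sum_nonneg fun i _ => sq_nonneg _
    calc (h : ℝ) ^ (2 * r) *
          (N⁻¹ * ∑ b : Fin l, (∑ i, revCoeff m (X ^ ((b : ℕ) * n) * q) i * z i) ^ 2)
        ≤ (h : ℝ) ^ (2 * r) * (N⁻¹ * (4 ^ r * h * ∑ i, z i ^ 2)) := by gcongr
      _ = (4 ^ r * ∑ i, z i ^ 2) * N⁻¹ * (h * h ^ (2 * r)) := by ring
      _ ≤ (4 ^ r * ∑ i, z i ^ 2) * N⁻¹ * ((r + 1) * N) := by gcongr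
      _ = 4 ^ r * (r + 1) * ∑ i, z i ^ 2 := by field_simp

end TestVectors

/-! ### Nets of the sphere -/

/-- Volumetric bound: the balls of radius `ε / 2` about `ε`-separated points of the unit sphere
are disjoint and lie in the ball of radius `1 + ε / 2`. -/
theorem card_le_of_separated_sphere {E : Type*} [NormedAddCommGroup E] [NormedSpace ℝ E]
    [FiniteDimensional ℝ E] {ε : ℝ} (hε : 0 < ε) (s : Finset E) (hs : ∀ c ∈ s, ‖c‖ = 1)
    (h : ∀ c ∈ s, ∀ d ∈ s, c ≠ d → ε ≤ ‖c - d‖) :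
    (s.card : ℝ) ≤ (1 + 2 / ε) ^ Module.finrank ℝ E := by
  borelize E
  let μ : Measure E := Measure.addHaar
  have hδ : 0 < ε / 2 := by positivity
  have hρ : 0 < 1 + ε / 2 := by positivity
  have D : Set.Pairwise (s : Set E) (Function.onFun Disjoint fun c => Metric.ball c (ε / 2)) := by
    rintro c hc d hd hcd
    apply Metric.ball_disjoint_ball
    rw [dist_eq_norm, add_halves]
    exact h c hc d hd hcd
  have hsub : (⋃ c ∈ s, Metric.ball c (ε / 2)) ⊆ Metric.ball 0 (1 + ε / 2) := by
    refine Set.iUnion₂_subset fun c hc => Metric.ball_subset_ball' ?_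
    rw [dist_zero_right, hs c hc, add_comm]
  have hvol : (s.card : ENNReal) * ENNReal.ofReal ((ε / 2) ^ Module.finrank ℝ E)
      * μ (Metric.ball 0 1) ≤
      ENNReal.ofReal ((1 + ε / 2) ^ Module.finrank ℝ E) * μ (Metric.ball 0 1) :=
    calc _ = μ (⋃ c ∈ s, Metric.ball c (ε / 2)) := by
          rw [measure_biUnion_finset D fun c _ => measurableSet_ball]
          simp only [μ.addHaar_ball_of_pos _ hδ, Finset.sum_const, nsmul_eq_mul, mul_assoc]
      _ ≤ μ (Metric.ball 0 (1 + ε / 2)) := measure_mono hsub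
      _ = _ := by rw [μ.addHaar_ball_of_pos _ hρ]
  have hcard := (ENNReal.mul_le_mul_iff_left
    (Metric.measure_ball_pos _ _ zero_lt_one).ne' measure_ball_lt_top.ne).1 hvol
  have hreal := ENNReal.toReal_le_of_le_ofReal (pow_nonneg hρ.le _) hcard
  rw [ENNReal.toReal_mul, ENNReal.toReal_natCast, ENNReal.toReal_ofReal (by positivity)] at hreal
  have : (1 + 2 / ε : ℝ) = (1 + ε / 2) / (ε / 2) := by field_simp; ring
  rw [this, div_pow, le_div_iff₀ (by positivity)]
  exact hreal

/-- The unit sphere has an `ε`-net of at most `(1 + 2 / ε) ^ d` points: take a maximal separated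
subset. -/
theorem exists_sphere_net {E : Type*} [NormedAddCommGroup E] [NormedSpace ℝ E]
    [FiniteDimensional ℝ E] {ε : ℝ} (hε : 0 < ε) :
    ∃ s : Finset E, (∀ c ∈ s, ‖c‖ = 1) ∧ (∀ y : E, ‖y‖ = 1 → ∃ c ∈ s, ‖y - c‖ ≤ ε) ∧
      (s.card : ℝ) ≤ (1 + 2 / ε) ^ Module.finrank ℝ E := by
  classical
  let good : Finset E → Prop := fun s =>
    (∀ c ∈ s, ‖c‖ = 1) ∧ ∀ c ∈ s, ∀ d ∈ s, c ≠ d → ε ≤ ‖c - d‖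
  have hbd : ∀ n : ℕ, (∃ s, good s ∧ s.card = n) →
      n ≤ ⌊(1 + 2 / ε) ^ Module.finrank ℝ E⌋₊ := by
    rintro n ⟨s, hs, rfl⟩
    exact Nat.le_floor (card_le_of_separated_sphere hε s hs.1 hs.2)
  obtain ⟨s, hs, hmax⟩ : ∃ s, good s ∧ ∀ t, good t → t.card ≤ s.card := by
    have hne : ∃ n, ∃ s, good s ∧ s.card = n := ⟨0, ∅, by simp [good], rfl⟩
    obtain ⟨s, hs, hcard⟩ := Nat.findGreatest_spec (P := fun n => ∃ s, good s ∧ s.card = n)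
      (hbd _ hne.choose_spec) hne.choose_spec
    exact ⟨s, hs, fun t ht => hcard ▸ Nat.le_findGreatest (hbd _ ⟨t, ht, rfl⟩) ⟨t, ht, rfl⟩⟩
  refine ⟨s, hs.1, fun y hy => ?_, card_le_of_separated_sphere hε s hs.1 hs.2⟩
  by_contra! hcon
  have hys : y ∉ s := fun hmem => by
    have := hcon y hmem
    simp at this
    linarith
  have hgood : good (insert y s) := by
    refine ⟨fun c hc => ?_, fun c hc d hd hcd => ?_⟩
    · rcases Finset.mem_insert.1 hc with rfl | hc
      · exact hy
      · exact hs.1 c hc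
    · rcases Finset.mem_insert.1 hc with rfl | hcs <;>
        rcases Finset.mem_insert.1 hd with rfl | hds
      · exact absurd rfl hcd
      · exact (hcon d hds).le
      · rw [norm_sub_rev]; exact (hcon c hcs).le
      · exact hs.2 c hcs d hds hcd
  have := hmax _ hgood
  rw [Finset.card_insert_of_notMem hys] at this
  omega

/-- Passage from a net to the whole space: an upper bound `b` on the net gives operator norm at
most `2 b`, and then the lower bound `a` degrades by at most `2 b ε`. -/
theorem lower_bound_of_net {E F : Type*} [NormedAddCommGroup E] [NormedSpace ℝ E]
    [NormedAddCommGroup F] [NormedSpace ℝ F] (T : E →L[ℝ] F) {ε a b : ℝ} (hε : 0 ≤ ε)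
    (hε2 : ε ≤ 1 / 2) (hb : 0 ≤ b) (s : Finset E)
    (hnet : ∀ y : E, ‖y‖ = 1 → ∃ c ∈ s, ‖y - c‖ ≤ ε)
    (hlow : ∀ c ∈ s, a ≤ ‖T c‖) (hup : ∀ c ∈ s, ‖T c‖ ≤ b) (x : E) :
    (a - 2 * b * ε) * ‖x‖ ≤ ‖T x‖ := by
  have hunit : ∀ {M : ℝ} {g : E → ℝ}, (∀ y, ‖y‖ = 1 → M ≤ g y) →
      (∀ (t : ℝ) y, 0 < t → g (t • y) = t * g y) → ∀ y, y ≠ 0 → M * ‖y‖ ≤ g y := by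
    intro M g hg hhom y hy
    have hy' : 0 < ‖y‖ := norm_pos_iff.2 hy
    have h1 := hg (‖y‖⁻¹ • y) (by rw [norm_smul, norm_inv, norm_norm, inv_mul_cancel₀ hy'.ne'])
    rw [hhom _ _ (inv_pos.2 hy')] at h1
    calc M * ‖y‖ ≤ (‖y‖⁻¹ * g y) * ‖y‖ := mul_le_mul_of_nonneg_right h1 hy'.le
      _ = g y := by field_simp
  have hnormT : ‖T‖ ≤ 2 * b := by
    have hle : ‖T‖ ≤ b + ε * ‖T‖ := by
      refine T.opNorm_le_bound (by positivity) fun y => ?_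
      by_cases hy : y = 0
      · simp [hy]
      have := hunit (M := -(b + ε * ‖T‖)) (g := fun y => -‖T y‖) (fun y hy => ?_)
        (fun t y ht => by simp [norm_smul, abs_of_pos ht]) y hy
      · linarith
      · obtain ⟨c, hc, hyc⟩ := hnet y hy
        have h1 : T y = T c + T (y - c) := by simp
        have h2 := norm_add_le (T c) (T (y - c))
        have h3 := T.le_opNorm (y - c)
        have h4 := hup c hc
        have h5 := mul_le_mul_of_nonneg_left hyc (norm_nonneg T)
        rw [← h1] at h2
        linarith
    nlinarith [norm_nonneg T]
  by_cases hx : x = 0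
  · simp [hx]
  refine hunit (g := fun y => ‖T y‖) (fun y hy => ?_)
    (fun t y ht => by simp [norm_smul, abs_of_pos ht]) x hx
  obtain ⟨c, hc, hyc⟩ := hnet y hy
  have h1 : T c = T y - T (y - c) := by simp
  have h2 := norm_sub_le (T y) (T (y - c))
  rw [← h1] at h2
  have h3 := T.le_opNorm (y - c)
  have h4 := hlow c hc
  have h5 : ‖T‖ * ‖y - c‖ ≤ 2 * b * ε := mul_le_mul hnormT hyc (norm_nonneg _) (by positivity)
  linarith

/-! ### Sub-Gaussian variables -/

/-- Square-exponential integrability: the layer-cake formula turns the tail bound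
`ℙ(|ξ| > t) ≤ e ^ (1 - κ t²)` into `∫ e / t² dt` over `(1, ∞)`. -/
theorem IsSubGaussianWith.lintegral_exp_sq_le {Ω : Type*} [MeasurableSpace Ω] {P : Measure Ω}
    [IsProbabilityMeasure P] {ξ : Ω → ℝ} {κ : ℝ} (h : IsSubGaussianWith ξ κ P)
    (hξ : Measurable ξ) :
    ∫⁻ ω, ENNReal.ofReal (Real.exp (κ / 2 * ξ ω ^ 2)) ∂P ≤ ENNReal.ofReal (1 + Real.exp 1) := by
  obtain ⟨hκ, htail⟩ := h
  rw [lintegral_eq_lintegral_meas_lt P (ae_of_all _ fun ω => (Real.exp_pos _).le)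
    (by fun_prop)]
  rw [← Set.Ioc_union_Ioi_eq_Ioi (zero_le_one' ℝ),
    lintegral_union measurableSet_Ioi (Set.Ioc_disjoint_Ioi le_rfl),
    ENNReal.ofReal_add zero_le_one (Real.exp_pos 1).le]
  refine add_le_add ?_ ?_
  · calc ∫⁻ t in Set.Ioc (0 : ℝ) 1, P {ω | t < Real.exp (κ / 2 * ξ ω ^ 2)}
        ≤ ∫⁻ t in Set.Ioc (0 : ℝ) 1, 1 := lintegral_mono fun t => prob_le_one
      _ = ENNReal.ofReal 1 := by simp
  · have hle : ∀ t ∈ Set.Ioi (1 : ℝ), P {ω | t < Real.exp (κ / 2 * ξ ω ^ 2)} ≤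
        ENNReal.ofReal (Real.exp 1 * t ^ (-2 : ℝ)) := by
      intro t ht
      have ht1 : (1 : ℝ) < t := ht
      have ht0 : (0 : ℝ) < t := by linarith
      have hlog : 0 ≤ 2 * Real.log t / κ := by have := Real.log_pos ht1; positivity
      have hs := htail (Real.sqrt (2 * Real.log t / κ)) (Real.sqrt_nonneg _)
      rw [Real.sq_sqrt hlog] at hs
      have hexp : Real.exp (1 - κ * (2 * Real.log t / κ)) = Real.exp 1 * t ^ (-2 : ℝ) := by
        rw [Real.rpow_def_of_pos ht0, ← Real.exp_add]
        congr 1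
        field_simp
        ring
      rw [hexp] at hs
      rw [← ENNReal.ofReal_toReal (measure_ne_top P {ω | t < Real.exp (κ / 2 * ξ ω ^ 2)})]
      refine ENNReal.ofReal_le_ofReal (le_trans ?_ hs)
      refine measureReal_mono (fun ω hω => ?_)
      have hω' : t < Real.exp (κ / 2 * ξ ω ^ 2) := hω
      have h1 : Real.log t < κ / 2 * ξ ω ^ 2 := (Real.log_lt_iff_lt_exp ht0).2 hω'
      refine Real.sqrt_lt_sqrt_iff hlog |>.2 (?_ : _ < ξ ω ^ 2) |>.trans_eq (Real.sqrt_sq_eq_abs _)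
      rw [div_lt_iff₀ hκ]
      linarith
    calc ∫⁻ t in Set.Ioi (1 : ℝ), P {ω | t < Real.exp (κ / 2 * ξ ω ^ 2)}
        ≤ ∫⁻ t in Set.Ioi (1 : ℝ), ENNReal.ofReal (Real.exp 1 * t ^ (-2 : ℝ)) :=
          setLIntegral_mono' measurableSet_Ioi hle
      _ = ENNReal.ofReal (∫ t in Set.Ioi (1 : ℝ), Real.exp 1 * t ^ (-2 : ℝ)) := by
          rw [ofReal_integral_eq_lintegral_ofReal]
          · exact (integrableOn_Ioi_rpow_of_lt (by norm_num) one_pos).const_mul _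
          · filter_upwards [ae_restrict_mem measurableSet_Ioi] with t ht
            have : (0 : ℝ) < t := lt_trans one_pos ht
            positivity
      _ = ENNReal.ofReal (Real.exp 1) := by
          rw [integral_const_mul, integral_Ioi_rpow_of_lt (by norm_num) one_pos]
          norm_num

theorem IsSubGaussianWith.integrable_exp_sq {Ω : Type*} [MeasurableSpace Ω] {P : Measure Ω}
    [IsProbabilityMeasure P] {ξ : Ω → ℝ} {κ : ℝ} (h : IsSubGaussianWith ξ κ P)
    (hξ : Measurable ξ) : Integrable (fun ω => Real.exp (κ / 2 * ξ ω ^ 2)) P := by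
  refine ⟨by fun_prop, ?_⟩
  rw [hasFiniteIntegral_iff_ofReal (ae_of_all _ fun ω => (Real.exp_pos _).le)]
  exact (h.lintegral_exp_sq_le hξ).trans_lt ENNReal.ofReal_lt_top

theorem IsSubGaussianWith.integral_exp_sq_le {Ω : Type*} [MeasurableSpace Ω] {P : Measure Ω}
    [IsProbabilityMeasure P] {ξ : Ω → ℝ} {κ : ℝ} (h : IsSubGaussianWith ξ κ P)
    (hξ : Measurable ξ) : ∫ ω, Real.exp (κ / 2 * ξ ω ^ 2) ∂P ≤ 1 + Real.exp 1 := by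
  rw [integral_eq_lintegral_of_nonneg_ae (ae_of_all _ fun ω => (Real.exp_pos _).le)
    (by fun_prop)]
  exact ENNReal.toReal_le_of_le_ofReal (by positivity) (h.lintegral_exp_sq_le hξ)

theorem exp_le_add_exp_sq (x : ℝ) : Real.exp x ≤ x + Real.exp (x ^ 2) := by
  have h0 := Real.add_one_le_exp (x ^ 2)
  rcases le_total |x| 1 with hx | hx
  · have h1 := Real.abs_exp_sub_one_sub_id_le hx
    have := (abs_le.1 h1).2
    linarith
  · rcases le_total 0 x with h | h
    · rw [abs_of_nonneg h] at hx
      have : Real.exp x ≤ Real.exp (x ^ 2) := Real.exp_le_exp.2 (by nlinarith)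
      linarith
    · rw [abs_of_nonpos h] at hx
      have : Real.exp x ≤ 1 := Real.exp_le_one_iff.2 h
      nlinarith

/-- Convexity of `exp`: the exponential of a fraction `u ∈ [0, 1]` of `y` lies below the chord. -/
theorem exp_mul_le_chord {u : ℝ} (hu0 : 0 ≤ u) (hu1 : u ≤ 1) (y : ℝ) :
    Real.exp (u * y) ≤ 1 + u * (Real.exp y - 1) := by
  have := convexOn_exp.2 (Set.mem_univ 0) (Set.mem_univ y) (by linarith : 0 ≤ 1 - u) hu0 (by ring)
  simp only [smul_eq_mul, mul_zero, zero_add, Real.exp_zero] at this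
  linarith

/-- The sub-Gaussian variance proxy that the parameter `κ` yields for a centred variable. -/
noncomputable def varianceProxy (κ : ℝ) : NNReal := Real.toNNReal (2 * (1 + 2 * Real.exp 1) / κ)

theorem coe_varianceProxy {κ : ℝ} (hκ : 0 < κ) :
    (varianceProxy κ : ℝ) = 2 * (1 + 2 * Real.exp 1) / κ :=
  Real.coe_toNNReal _ (by positivity)

/-- For small `t` the inequality `exp x ≤ x + exp (x²)` removes the linear term; for large `t` the
product `t * ξ` is split by the arithmetic-geometric mean inequality. -/
theorem IsSubGaussianWith.hasSubgaussianMGF {Ω : Type*} [MeasurableSpace Ω] {P : Measure Ω}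
    [IsProbabilityMeasure P] {ξ : Ω → ℝ} {κ : ℝ} (h : IsSubGaussianWith ξ κ P)
    (hξ : Measurable ξ) (h0 : ∫ ω, ξ ω ∂P = 0) :
    HasSubgaussianMGF ξ (varianceProxy κ) P := by
  have hκ := h.1
  have hint := h.integrable_exp_sq hξ
  have hM := h.integral_exp_sq_le hξ
  set s : ℝ := κ / 2 with hs
  have hspos : 0 < s := by positivity
  have he := Real.exp_pos 1
  have amgm : ∀ t ω, Real.exp (t * ξ ω) ≤ Real.exp (t ^ 2 / (2 * s)) * Real.exp (s * ξ ω ^ 2) := by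
    intro t ω
    rw [← Real.exp_add]
    refine Real.exp_le_exp.2 ?_
    have h1 : t ^ 2 / (2 * s) + s * ξ ω ^ 2 - t * ξ ω
        = ((t - s * ξ ω) ^ 2 + (s * ξ ω) ^ 2) / (2 * s) := by
      field_simp; ring
    have h2 : 0 ≤ ((t - s * ξ ω) ^ 2 + (s * ξ ω) ^ 2) / (2 * s) := by positivity
    linarith
  have hI : ∀ t, Integrable (fun ω => Real.exp (t * ξ ω)) P := by
    intro t
    refine (hint.const_mul (Real.exp (t ^ 2 / (2 * s)))).mono' (by fun_prop) ?_
    exact ae_of_all _ fun ω => by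
      rw [Real.norm_of_nonneg (Real.exp_pos _).le]; exact amgm t ω
  refine ⟨hI, fun t => ?_⟩
  rw [coe_varianceProxy hκ]
  have hR : 2 * (1 + 2 * Real.exp 1) / κ * t ^ 2 / 2
      = t ^ 2 / (2 * s) + t ^ 2 / s * Real.exp 1 := by
    rw [hs]; field_simp
  rw [hR]
  -- `exp (s ξ²)` dominates `|ξ|`, up to a constant factor.
  have hξint : Integrable ξ P := by
    refine (hint.const_mul (1 + 1 / s)).mono' (by fun_prop) (ae_of_all _ fun ω => ?_)
    have h1 := Real.add_one_le_exp (s * ξ ω ^ 2)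
    have h2 : |ξ ω| ≤ 1 + ξ ω ^ 2 := by
      nlinarith [sq_abs (ξ ω), sq_nonneg (|ξ ω| - 1), abs_nonneg (ξ ω)]
    have h3 : 1 + ξ ω ^ 2 ≤ (1 + 1 / s) * (s * ξ ω ^ 2 + 1) := by
      have : (1 + 1 / s) * (s * ξ ω ^ 2 + 1) = s * ξ ω ^ 2 + 1 + ξ ω ^ 2 + 1 / s := by
        field_simp
        ring
      rw [this]
      have : 0 ≤ 1 / s := by positivity
      nlinarith [sq_nonneg (ξ ω)]
    rw [Real.norm_eq_abs]
    refine h2.trans (h3.trans ?_)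
    exact mul_le_mul_of_nonneg_left h1 (by positivity)
  unfold mgf
  rcases le_total (t ^ 2) s with hts | hts
  · have hu0 : 0 ≤ t ^ 2 / s := by positivity
    have hu1 : t ^ 2 / s ≤ 1 := (div_le_one hspos).2 hts
    have hpt : ∀ ω, Real.exp (t * ξ ω) ≤
        t * ξ ω + (1 + t ^ 2 / s * (Real.exp (s * ξ ω ^ 2) - 1)) := by
      intro ω
      have h1 := exp_le_add_exp_sq (t * ξ ω)
      have h2 := exp_mul_le_chord hu0 hu1 (s * ξ ω ^ 2)
      have h3 : t ^ 2 / s * (s * ξ ω ^ 2) = (t * ξ ω) ^ 2 := by field_simp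
      rw [h3] at h2
      linarith
    have hA : Integrable (fun ω => t * ξ ω) P := hξint.const_mul t
    have hB : Integrable (fun ω => t ^ 2 / s * (Real.exp (s * ξ ω ^ 2) - 1)) P :=
      (hint.sub (integrable_const 1)).const_mul _
    have hC : Integrable (fun ω => 1 + t ^ 2 / s * (Real.exp (s * ξ ω ^ 2) - 1)) P :=
      (integrable_const 1).add hB
    calc ∫ ω, Real.exp (t * ξ ω) ∂P
        ≤ ∫ ω, (t * ξ ω + (1 + t ^ 2 / s * (Real.exp (s * ξ ω ^ 2) - 1))) ∂P :=
          integral_mono (hI t) (hA.add hC) hpt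
      _ = 1 + t ^ 2 / s * (∫ ω, Real.exp (s * ξ ω ^ 2) ∂P - 1) := by
          rw [integral_add hA hC, integral_add (integrable_const 1) hB, integral_const_mul,
            integral_const_mul, integral_sub hint (integrable_const 1), h0]
          simp
      _ ≤ 1 + t ^ 2 / s * Real.exp 1 := by
          have := mul_le_mul_of_nonneg_left (by linarith :
            ∫ ω, Real.exp (s * ξ ω ^ 2) ∂P - 1 ≤ Real.exp 1) hu0
          linarith
      _ ≤ Real.exp (t ^ 2 / s * Real.exp 1) := by
          have := Real.add_one_le_exp (t ^ 2 / s * Real.exp 1); linarith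
      _ ≤ _ := Real.exp_le_exp.2 (by
          have : 0 ≤ t ^ 2 / (2 * s) := by positivity
          linarith)
  · have hu1 : 1 ≤ t ^ 2 / s := (one_le_div hspos).2 hts
    calc ∫ ω, Real.exp (t * ξ ω) ∂P
        ≤ ∫ ω, Real.exp (t ^ 2 / (2 * s)) * Real.exp (s * ξ ω ^ 2) ∂P :=
          integral_mono (hI t) (hint.const_mul _) (amgm t)
      _ = Real.exp (t ^ 2 / (2 * s)) * ∫ ω, Real.exp (s * ξ ω ^ 2) ∂P := integral_const_mul _ _
      _ ≤ Real.exp (t ^ 2 / (2 * s)) * (Real.exp 1 + 1) :=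
          mul_le_mul_of_nonneg_left (by linarith) (Real.exp_pos _).le
      _ ≤ Real.exp (t ^ 2 / (2 * s)) * Real.exp (t ^ 2 / s * Real.exp 1) := by
          refine mul_le_mul_of_nonneg_left ?_ (Real.exp_pos _).le
          refine (Real.add_one_le_exp _).trans (Real.exp_le_exp.2 ?_)
          nlinarith
      _ = _ := (Real.exp_add _ _).symm

/-- Conversely, a sub-Gaussian moment generating function gives the two-sided tail bound; the
factor `2` of the union bound is absorbed by `e`. -/
theorem ProbabilityTheory.HasSubgaussianMGF.isSubGaussianWith {Ω : Type*} [MeasurableSpace Ω]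
    {P : Measure Ω}
    [IsProbabilityMeasure P] {Y : Ω → ℝ} {K : NNReal} (hK : 0 < K)
    (h : HasSubgaussianMGF Y K P) : IsSubGaussianWith Y (1 / (2 * K)) P := by
  have hK' : (0 : ℝ) < K := by exact_mod_cast hK
  refine ⟨by positivity, fun t ht => ?_⟩
  have h1 := h.measure_ge_le ht
  have h2 := h.neg.measure_ge_le ht
  have hsub : {ω | t < |Y ω|} ⊆ {ω | t ≤ Y ω} ∪ {ω | t ≤ (-Y) ω} := by
    intro ω hω
    rcases lt_abs.1 (show t < |Y ω| from hω) with h | h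
    · exact Or.inl h.le
    · exact Or.inr h.le
  have h3 := (measureReal_mono hsub (μ := P)).trans (measureReal_union_le _ _)
  have h4 : Real.exp (1 - 1 / (2 * K) * t ^ 2) = Real.exp 1 * Real.exp (-t ^ 2 / (2 * K)) := by
    rw [← Real.exp_add]; congr 1; ring
  have h5 : (2 : ℝ) ≤ Real.exp 1 := by have := Real.add_one_le_exp (1 : ℝ); linarith
  rw [h4]
  have := Real.exp_pos (-t ^ 2 / (2 * (K : ℝ)))
  nlinarith

/-- A fourth-moment bound, from `y⁴ ≤ 12 (exp y + exp (-y))`. -/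
theorem ProbabilityTheory.HasSubgaussianMGF.integral_pow_four_le {Ω : Type*} [MeasurableSpace Ω]
    {P : Measure Ω}
    [IsProbabilityMeasure P] {Y : Ω → ℝ} {K : NNReal} (h : HasSubgaussianMGF Y K P) :
    Integrable (fun ω => Y ω ^ 4) P ∧ ∫ ω, Y ω ^ 4 ∂P ≤ 48 * Real.exp (K / 2) := by
  have hpos : ∀ y : ℝ, 0 ≤ y → y ^ 4 ≤ 24 * Real.exp y := by
    intro y hy
    have := Real.pow_div_factorial_le_exp y hy 4
    norm_num [Nat.factorial] at this
    linarith
  have hpt : ∀ y : ℝ, y ^ 4 ≤ 24 * (Real.exp (1 * y) + Real.exp ((-1) * y)) := by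
    intro y
    rw [one_mul, neg_one_mul]
    have e1 := Real.exp_pos y
    have e2 := Real.exp_pos (-y)
    rcases le_total 0 y with hy | hy
    · have := hpos y hy; linarith
    · have := hpos (-y) (by linarith)
      have h4 : (-y) ^ 4 = y ^ 4 := by ring
      linarith
  have i1 := h.integrable_exp_mul 1
  have i2 := h.integrable_exp_mul (-1)
  have hint : Integrable (fun ω => Y ω ^ 4) P := by
    refine ((i1.add i2).const_mul 24).mono' (h.aestronglyMeasurable.pow 4) (ae_of_all _ fun ω => ?_)
    rw [Real.norm_of_nonneg (by positivity)]
    exact hpt _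
  refine ⟨hint, ?_⟩
  calc ∫ ω, Y ω ^ 4 ∂P ≤ ∫ ω, 24 * (Real.exp (1 * Y ω) + Real.exp ((-1) * Y ω)) ∂P :=
        integral_mono hint ((i1.add i2).const_mul 24) fun ω => hpt _
    _ = 24 * (mgf Y P 1 + mgf Y P (-1)) := by
        rw [integral_const_mul, integral_add i1 i2]; rfl
    _ ≤ 24 * (Real.exp (K / 2) + Real.exp (K / 2)) := by
        have h1 := h.mgf_le 1
        have h2 := h.mgf_le (-1)
        norm_num at h1 h2
        linarith
    _ = _ := by ring

/-- If `𝔼 Y² = 1` and `𝔼 Y⁴ ≤ K`, the Laplace transform of `Y²` at `1 / K` is bounded by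
`exp (-1 / (2 K))`, by `exp (-v) ≤ 1 - v + v² / 2`. -/
theorem mgf_sq_neg_le {Ω : Type*} [MeasurableSpace Ω] {P : Measure Ω}
    [IsProbabilityMeasure P] {Y : Ω → ℝ} (hY : AEMeasurable Y P) {K : ℝ} (hK : 0 < K)
    (h2i : Integrable (fun ω => Y ω ^ 2) P) (h2 : ∫ ω, Y ω ^ 2 ∂P = 1)
    (h4i : Integrable (fun ω => Y ω ^ 4) P) (h4 : ∫ ω, Y ω ^ 4 ∂P ≤ K) :
    mgf (fun ω => Y ω ^ 2) P (-(1 / K)) ≤ Real.exp (-(1 / (2 * K))) := by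
  have hpt : ∀ v : ℝ, 0 ≤ v → Real.exp (-v) ≤ 1 - v + v ^ 2 / 2 := by
    intro v hv
    have h1 := Real.quadratic_le_exp_of_nonneg hv
    rw [Real.exp_neg]
    refine inv_le_of_inv_le₀ ?_ ?_
    · nlinarith [sq_nonneg (v - 1)]
    · refine le_trans ?_ h1
      rw [inv_le_iff_one_le_mul₀ (by nlinarith [sq_nonneg (v - 1)])]
      nlinarith [sq_nonneg (v ^ 2)]
  have hle : ∀ ω, Real.exp (-(1 / K) * Y ω ^ 2) ≤
      1 - 1 / K * Y ω ^ 2 + (1 / K) ^ 2 / 2 * Y ω ^ 4 := by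
    intro ω
    have := hpt (1 / K * Y ω ^ 2) (by positivity)
    rw [neg_mul]
    refine this.trans (le_of_eq (by ring))
  have iA : Integrable (fun ω => 1 - 1 / K * Y ω ^ 2) P :=
    (integrable_const 1).sub (h2i.const_mul _)
  have iB : Integrable (fun ω => (1 / K) ^ 2 / 2 * Y ω ^ 4) P := h4i.const_mul _
  have iE : Integrable (fun ω => Real.exp (-(1 / K) * Y ω ^ 2)) P := by
    refine (integrable_const (1 : ℝ)).mono' (by fun_prop) (ae_of_all _ fun ω => ?_)
    rw [Real.norm_of_nonneg (Real.exp_pos _).le]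
    refine Real.exp_le_one_iff.2 ?_
    have : 0 ≤ 1 / K * Y ω ^ 2 := by positivity
    linarith
  calc mgf (fun ω => Y ω ^ 2) P (-(1 / K))
      ≤ ∫ ω, (1 - 1 / K * Y ω ^ 2 + (1 / K) ^ 2 / 2 * Y ω ^ 4) ∂P :=
        integral_mono iE (iA.add iB) hle
    _ = 1 - 1 / K + (1 / K) ^ 2 / 2 * ∫ ω, Y ω ^ 4 ∂P := by
        rw [integral_add iA iB, integral_sub (integrable_const 1) (h2i.const_mul _),
          integral_const_mul, integral_const_mul, h2]
        simp
    _ ≤ 1 - 1 / K + (1 / K) ^ 2 / 2 * K := by gcongr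
    _ = -(1 / (2 * K)) + 1 := by field_simp; ring
    _ ≤ _ := Real.add_one_le_exp _

/-- Linear forms in disjoint groups of independent variables have squares whose moment generating
functions multiply. The coefficients `a b` live on the fibre of `idx` over `b`. -/
theorem ProbabilityTheory.iIndepFun.mgf_sum_sq_of_disjoint {Ω ι β : Type*} [MeasurableSpace Ω]
    {P : Measure Ω}
    [Fintype ι] [DecidableEq β] {X : ι → Ω → ℝ} (hX : ∀ i, Measurable (X i))
    (hind : iIndepFun X P) (idx : ι → β) (a : β → ι → ℝ) (ha : ∀ b i, a b i ≠ 0 → idx i = b)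
    (t : ℝ) (B : Finset β) :
    mgf (fun ω => ∑ b ∈ B, (∑ i, a b i * X i ω) ^ 2) P t =
      ∏ b ∈ B, mgf (fun ω => (∑ i, a b i * X i ω) ^ 2) P t := by
  classical
  have := hind.isProbabilityMeasure
  induction B using Finset.induction_on with
  | empty => simp
  | insert b B hb ih =>
    rw [Finset.prod_insert hb, ← ih]
    let S : Finset ι := Finset.univ.filter fun i => idx i = b
    let T : Finset ι := Finset.univ.filter fun i => idx i ∈ B
    have hST : Disjoint S T := by
      refine Finset.disjoint_left.2 fun i hi hi' => hb ?_
      have h1 : idx i = b := (Finset.mem_filter.1 hi).2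
      exact h1 ▸ (Finset.mem_filter.1 hi').2
    have hSum : ∀ (U : Finset ι) (c : β), (∀ i, idx i = c → i ∈ U) → ∀ ω,
        ∑ i, a c i * X i ω = ∑ i : U, a c i * X i ω := by
      intro U c hU ω
      rw [Finset.sum_coe_sort U fun i => a c i * X i ω]
      refine (Finset.sum_subset (Finset.subset_univ U) fun i _ hi => ?_).symm
      have : a c i = 0 := by
        by_contra hne
        exact hi (hU i (ha c i hne))
      rw [this, zero_mul]
    have hI := hind.indepFun_finset S T hST hX
    have hI2 := hI.comp (φ := fun x : S → ℝ => (∑ i : S, a b i * x i) ^ 2)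
      (ψ := fun x : T → ℝ => ∑ c ∈ B, (∑ i : T, a c i * x i) ^ 2) (by fun_prop) (by fun_prop)
    have e1 : (fun ω => (∑ i, a b i * X i ω) ^ 2)
        = (fun x : S → ℝ => (∑ i : S, a b i * x i) ^ 2) ∘ fun ω (i : S) => X i ω := by
      funext ω
      simp only [Function.comp]
      rw [hSum S b (fun i hi => by simp [S, hi]) ω]
    have e2 : (fun ω => ∑ c ∈ B, (∑ i, a c i * X i ω) ^ 2)
        = (fun x : T → ℝ => ∑ c ∈ B, (∑ i : T, a c i * x i) ^ 2) ∘ fun ω (i : T) => X i ω := by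
      funext ω
      simp only [Function.comp]
      refine Finset.sum_congr rfl fun c hc => ?_
      rw [hSum T c (fun i hi => by simp [T, hi, hc]) ω]
    rw [← e1, ← e2] at hI2
    have e3 : (fun ω => ∑ c ∈ insert b B, (∑ i, a c i * X i ω) ^ 2)
        = (fun ω => (∑ i, a b i * X i ω) ^ 2) + fun ω => ∑ c ∈ B, (∑ i, a c i * X i ω) ^ 2 := by
      funext ω
      simp [Finset.sum_insert hb]
    rw [e3]
    exact hI2.mgf_add (Measurable.aestronglyMeasurable (by fun_prop))
      (Measurable.aestronglyMeasurable (by fun_prop))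

/-! ### Concentration of sums of squares -/

/-- The fourth moment bound for unit-norm linear forms in variables of sub-Gaussian parameter
`κ`. -/
noncomputable def fourthMomentBound (κ : ℝ) : ℝ := 48 * Real.exp (varianceProxy κ / 2)

theorem fourthMomentBound_pos (κ : ℝ) : 0 < fourthMomentBound κ := by
  unfold fourthMomentBound; positivity

theorem hasSubgaussianMGF_linearForm {Ω ι : Type*} [MeasurableSpace Ω] {P : Measure Ω}
    [Fintype ι] {X : ι → Ω → ℝ} (hind : iIndepFun X P) {K : NNReal}
    (hK : ∀ i, HasSubgaussianMGF (X i) K P) {a : ι → ℝ} (ha : ∑ i, a i ^ 2 = 1) :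
    HasSubgaussianMGF (fun ω => ∑ i, a i * X i ω) K P := by
  have hind' : iIndepFun (fun i ω => a i * X i ω) P :=
    hind.comp (fun i x => a i * x) fun i => measurable_const_mul _
  have hmul : ∀ i, HasSubgaussianMGF (fun ω => a i * X i ω) (Real.toNNReal (a i ^ 2) * K) P := by
    intro i
    have hc : (Real.toNNReal (a i ^ 2) : ℝ) = a i ^ 2 := Real.coe_toNNReal _ (sq_nonneg _)
    have h := (hK i).const_mul (a i)
    refine ⟨h.integrable_exp_mul, fun t => (h.mgf_le t).trans_eq ?_⟩
    rw [NNReal.coe_mul, hc]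
    rfl
  have h := HasSubgaussianMGF.sum_of_iIndepFun hind' (s := Finset.univ) fun i _ => hmul i
  have hsum : ∑ i, Real.toNNReal (a i ^ 2) = 1 := by
    rw [← Real.toNNReal_sum_of_nonneg fun i _ => sq_nonneg _, ha, Real.toNNReal_one]
  rwa [← Finset.sum_mul, hsum, one_mul] at h

theorem integral_sq_linearForm {Ω ι : Type*} [MeasurableSpace Ω] {P : Measure Ω}
    [Fintype ι] {X : ι → Ω → ℝ} (hind : iIndepFun X P) (hL : ∀ i, MemLp (X i) 2 P)
    (h0 : ∀ i, ∫ ω, X i ω ∂P = 0) (h1 : ∀ i, variance (X i) P = 1)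
    {a : ι → ℝ} (ha : ∑ i, a i ^ 2 = 1) :
    ∫ ω, (∑ i, a i * X i ω) ^ 2 ∂P = 1 := by
  have := hind.isProbabilityMeasure
  have hL' : ∀ i ∈ Finset.univ, MemLp (fun ω => a i * X i ω) 2 P := fun i _ =>
    (hL i).const_mul (a i)
  have hind' : iIndepFun (fun i ω => a i * X i ω) P :=
    hind.comp (fun i x => a i * x) fun i => measurable_const_mul _
  have hv := IndepFun.variance_sum (s := Finset.univ) hL' fun i _ j _ hij => hind'.indepFun hij
  have hmean : ∫ ω, (∑ i, fun ω => a i * X i ω) ω ∂P = 0 := by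
    simp only [Finset.sum_apply]
    rw [integral_finsetSum _ fun i hi => (hL' i hi).integrable one_le_two]
    simp [integral_const_mul, h0]
  rw [variance_of_integral_eq_zero
    (memLp_finsetSum' _ hL').aestronglyMeasurable.aemeasurable hmean] at hv
  simp only [Finset.sum_apply, variance_const_mul, h1, mul_one, ha] at hv
  exact hv

section Concentration

variable {Ω ι : Type*} [MeasurableSpace Ω] {P : Measure Ω} [Fintype ι]
  {X : ι → Ω → ℝ} {κ : ℝ} {l : ℕ} {idx : ι → ℕ} {a : Fin l → ι → ℝ}

/-- Chernoff bound for small values of a sum of squares of independent unit-variance linear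
forms. -/
theorem measureReal_sum_sq_le (hX : ∀ i, Measurable (X i)) (hind : iIndepFun X P)
    (h0 : ∀ i, ∫ ω, X i ω ∂P = 0) (h1 : ∀ i, variance (X i) P = 1)
    (hsub : ∀ i, IsSubGaussianWith (X i) κ P)
    (hidx : ∀ b i, a b i ≠ 0 → idx i = b) (ha : ∀ b, ∑ i, a b i ^ 2 = 1) :
    P.real {ω | ∑ b, (∑ i, a b i * X i ω) ^ 2 ≤ (l : ℝ) / 4} ≤
      Real.exp (-(l / (4 * fourthMomentBound κ))) := by
  have := hind.isProbabilityMeasure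
  set K := fourthMomentBound κ with hKdef
  have hK : 0 < K := fourthMomentBound_pos κ
  have hmgf : ∀ i, HasSubgaussianMGF (X i) (varianceProxy κ) P := fun i =>
    (hsub i).hasSubgaussianMGF (hX i) (h0 i)
  have hY : ∀ b, HasSubgaussianMGF (fun ω => ∑ i, a b i * X i ω) (varianceProxy κ) P :=
    fun b => hasSubgaussianMGF_linearForm hind hmgf (ha b)
  have hone : ∀ b, mgf (fun ω => (∑ i, a b i * X i ω) ^ 2) P (-(1 / K)) ≤
      Real.exp (-(1 / (2 * K))) := fun b =>
    mgf_sq_neg_le (hY b).aemeasurable hK ((hY b).memLp 2).integrable_sq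
      (integral_sq_linearForm hind (fun i => (hmgf i).memLp 2) h0 h1 (ha b))
      (HasSubgaussianMGF.integral_pow_four_le (hY b)).1
      (HasSubgaussianMGF.integral_pow_four_le (hY b)).2
  have hneg : -(1 / K) ≤ 0 := neg_nonpos.2 (by positivity)
  have hprod : mgf (fun ω => ∑ b, (∑ i, a b i * X i ω) ^ 2) P (-(1 / K)) ≤
      Real.exp (-(1 / (2 * K))) ^ l := by
    have := iIndepFun.mgf_sum_sq_of_disjoint hX hind idx
      (fun c i => if h : c < l then a ⟨c, h⟩ i else 0)
      (fun c i h => by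
        by_cases hc : c < l
        · simp only [hc, dif_pos] at h
          exact hidx ⟨c, hc⟩ i h
        · simp [hc] at h) (-(1 / K)) (Finset.range l)
    rw [Finset.prod_range] at this
    simp only [Finset.sum_range, Fin.is_lt, dif_pos, Fin.eta] at this
    rw [this]
    calc ∏ b : Fin l, mgf (fun ω => (∑ i, a b i * X i ω) ^ 2) P (-(1 / K))
        ≤ ∏ _b : Fin l, Real.exp (-(1 / (2 * K))) :=
          Finset.prod_le_prod (fun b _ => mgf_nonneg) fun b _ => hone b
      _ = _ := by simp
  have hint : Integrable (fun ω => Real.exp (-(1 / K) *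
      ∑ b, (∑ i, a b i * X i ω) ^ 2)) P := by
    refine (integrable_const (1 : ℝ)).mono' (by fun_prop) (ae_of_all _ fun ω => ?_)
    rw [Real.norm_of_nonneg (Real.exp_pos _).le]
    refine Real.exp_le_one_iff.2 (mul_nonpos_of_nonpos_of_nonneg hneg ?_)
    exact Finset.sum_nonneg fun b _ => sq_nonneg _
  refine (measure_le_le_exp_mul_mgf _ hneg hint).trans ?_
  refine (mul_le_mul_of_nonneg_left hprod (Real.exp_pos _).le).trans (le_of_eq ?_)
  rw [← Real.exp_nat_mul, ← Real.exp_add]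
  congr 1
  field_simp
  ring

/-- Chernoff bound for large values of a sum of squares of independent sub-Gaussian linear
forms. -/
theorem measureReal_le_sum_sq (hκ : 0 < κ) (hX : ∀ i, Measurable (X i)) (hind : iIndepFun X P)
    (h0 : ∀ i, ∫ ω, X i ω ∂P = 0)
    (hsub : ∀ i, IsSubGaussianWith (X i) κ P)
    (hidx : ∀ b i, a b i ≠ 0 → idx i = b) (ha : ∀ b, ∑ i, a b i ^ 2 = 1) :
    P.real {ω | 12 * varianceProxy κ * (l : ℝ) ≤ ∑ b, (∑ i, a b i * X i ω) ^ 2} ≤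
      Real.exp (-l) := by
  have := hind.isProbabilityMeasure
  have hK' : (0 : ℝ) < varianceProxy κ := by rw [coe_varianceProxy hκ]; positivity
  have hK : 0 < varianceProxy κ := by exact_mod_cast hK'
  have hmgf : ∀ i, HasSubgaussianMGF (X i) (varianceProxy κ) P := fun i =>
    (hsub i).hasSubgaussianMGF (hX i) (h0 i)
  have hY : ∀ b, IsSubGaussianWith (fun ω => ∑ i, a b i * X i ω) (1 / (2 * varianceProxy κ)) P :=
    fun b => HasSubgaussianMGF.isSubGaussianWith hK
      (hasSubgaussianMGF_linearForm hind hmgf (ha b))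
  set s : ℝ := 1 / (2 * varianceProxy κ) / 2 with hs
  have hspos : 0 < s := by positivity
  have hint : ∀ b, Integrable (fun ω => Real.exp (s * (∑ i, a b i * X i ω) ^ 2)) P := fun b =>
    (hY b).integrable_exp_sq (by fun_prop)
  have hone : ∀ b, mgf (fun ω => (∑ i, a b i * X i ω) ^ 2) P s ≤ Real.exp 2 := fun b => by
    refine ((hY b).integral_exp_sq_le (by fun_prop)).trans ?_
    have h2 : Real.exp 2 = Real.exp 1 * Real.exp 1 := by rw [← Real.exp_add]; norm_num
    have := Real.add_one_le_exp (1 : ℝ)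
    nlinarith
  have hprod := iIndepFun.mgf_sum_sq_of_disjoint hX hind idx
    (fun c i => if h : c < l then a ⟨c, h⟩ i else 0)
    (fun c i h => by
      by_cases hc : c < l
      · simp only [hc, dif_pos] at h
        exact hidx ⟨c, hc⟩ i h
      · simp [hc] at h) s (Finset.range l)
  rw [Finset.prod_range] at hprod
  simp only [Finset.sum_range, Fin.is_lt, dif_pos, Fin.eta] at hprod
  have hle : mgf (fun ω => ∑ b, (∑ i, a b i * X i ω) ^ 2) P s ≤ Real.exp 2 ^ l := by
    rw [hprod]
    calc ∏ b : Fin l, mgf (fun ω => (∑ i, a b i * X i ω) ^ 2) P s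
        ≤ ∏ _b : Fin l, Real.exp 2 :=
          Finset.prod_le_prod (fun b _ => mgf_nonneg) fun b _ => hone b
      _ = _ := by simp
  -- A non-integrable exponential would have zero moment generating function by convention, which
  -- the positive product excludes.
  have hintS : Integrable (fun ω => Real.exp (s * ∑ b, (∑ i, a b i * X i ω) ^ 2)) P := by
    by_contra hcon
    have hz := mgf_undef hcon
    rw [hprod] at hz
    exact (Finset.prod_pos fun b _ => mgf_pos (hint b)).ne' hz
  refine (measure_ge_le_exp_mul_mgf _ hspos.le hintS).trans ?_
  refine (mul_le_mul_of_nonneg_left hle (Real.exp_pos _).le).trans (le_of_eq ?_)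
  rw [← Real.exp_nat_mul, ← Real.exp_add, hs]
  congr 1
  field_simp
  ring

end Concentration

/-! ### Singular values and the canonical dual -/

theorem l2norm_sq {n : ℕ} (v : Fin n → ℝ) : l2norm v ^ 2 = ∑ i, v i ^ 2 := by
  simp [l2norm, EuclideanSpace.real_norm_sq_eq]

theorem l2norm_nonneg {n : ℕ} (v : Fin n → ℝ) : 0 ≤ l2norm v := norm_nonneg _

theorem l2norm_le_sqrt_mul_norm {n : ℕ} (v : Fin n → ℝ) : l2norm v ≤ Real.sqrt n * ‖v‖ := by
  refine abs_le_of_sq_le_sq' ?_ (by positivity) |>.2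
  rw [l2norm_sq, mul_pow, Real.sq_sqrt (Nat.cast_nonneg n)]
  calc ∑ i, v i ^ 2 ≤ ∑ _i : Fin n, ‖v‖ ^ 2 := Finset.sum_le_sum fun i _ => by
        have h := norm_le_pi_norm v i
        rw [Real.norm_eq_abs] at h
        rw [← sq_abs]
        gcongr
    _ = n * ‖v‖ ^ 2 := by simp

/-- A lower bound for `A` on all vectors bounds its smallest singular value: evaluate it at an
eigenvector of `Aᵀ A`. -/
theorem le_sigmaMin {m k : ℕ} (hk : 0 < k) {A : Matrix (Fin m) (Fin k) ℝ} {s : ℝ}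
    (h : ∀ x : Fin k → ℝ, s * l2norm x ≤ l2norm (A.mulVec x)) : s ≤ sigmaMin A := by
  set T := Matrix.toEuclideanLin A with hT
  obtain ⟨v, hv⟩ := (T.hasEigenvalue_adjoint_comp_self_sq_singularValues
    (n := k - 1) (by simp; omega)).exists_hasEigenvector
  have hv0 : 0 < ‖v‖ := norm_pos_iff.2 hv.2
  have h1 : ‖T v‖ ^ 2 = sigmaMin A ^ 2 * ‖v‖ ^ 2 := by
    rw [← real_inner_self_eq_norm_sq, ← LinearMap.adjoint_inner_left,
      ← LinearMap.comp_apply, hv.apply_eq_smul]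
    simp only [RCLike.ofReal_real_eq_id, id, inner_smul_left, real_inner_self_eq_norm_sq]
    rfl
  have h2 : s * ‖v‖ ≤ ‖T v‖ := h v.ofLp
  have h3 : 0 ≤ sigmaMin A := LinearMap.singularValues_nonneg _ _
  have h4 : ‖T v‖ = sigmaMin A * ‖v‖ := by
    rw [← mul_pow] at h1
    exact (sq_eq_sq₀ (norm_nonneg _) (by positivity)).1 h1
  rw [h4] at h2
  exact le_of_mul_le_mul_right h2 hv0

/-- The canonical dual of a matrix bounded below by `s > 0` is a left inverse of norm at most
`1 / s`. -/
theorem canonicalDual_of_lowerBound {m k : ℕ} {A : Matrix (Fin m) (Fin k) ℝ} {s : ℝ} (hs : 0 < s)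
    (h : ∀ x : Fin k → ℝ, s * l2norm x ≤ l2norm (A.mulVec x)) :
    canonicalDual A * A = 1 ∧
      ∀ u : Fin m → ℝ, s * l2norm ((canonicalDual A).mulVec u) ≤ l2norm u := by
  have hdot : ∀ {n : ℕ} (v : Fin n → ℝ), v ⬝ᵥ v = l2norm v ^ 2 := fun v => by
    rw [l2norm_sq]; simp [dotProduct, sq]
  have hinj : Function.Injective (A.transpose * A).mulVec := by
    rw [← Matrix.coe_mulVecLin]
    refine (injective_iff_map_eq_zero (A.transpose * A).mulVecLin).2 fun x hx => ?_
    rw [Matrix.mulVecLin_apply, ← Matrix.mulVec_mulVec] at hx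
    have h1 : l2norm (A.mulVec x) ^ 2 = 0 := by
      rw [← hdot, Matrix.dotProduct_mulVec, ← Matrix.mulVec_transpose, hx, zero_dotProduct]
    have h2 := h x
    rw [pow_eq_zero_iff two_ne_zero |>.1 h1] at h2
    have h3 : l2norm x = 0 := le_antisymm (by nlinarith [l2norm_nonneg x]) (l2norm_nonneg x)
    have h4 : WithLp.toLp 2 x = (0 : EuclideanSpace ℝ (Fin k)) := norm_eq_zero.1 h3
    exact congrArg WithLp.ofLp h4
  have hunit : IsUnit (A.transpose * A).det :=
    (Matrix.isUnit_iff_isUnit_det _).1 (Matrix.mulVec_injective_iff_isUnit.1 hinj)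
  refine ⟨by rw [canonicalDual, Matrix.mul_assoc, Matrix.nonsing_inv_mul _ hunit], fun u => ?_⟩
  set v := (canonicalDual A).mulVec u with hv
  have hnormal : A.transpose.mulVec (A.mulVec v) = A.transpose.mulVec u := by
    rw [hv, canonicalDual, Matrix.mulVec_mulVec, Matrix.mulVec_mulVec, ← Matrix.mul_assoc,
      Matrix.mul_nonsing_inv _ hunit, Matrix.one_mul]
  have h1 : l2norm (A.mulVec v) ^ 2 = A.mulVec v ⬝ᵥ u := by
    rw [← hdot, Matrix.dotProduct_mulVec, ← Matrix.mulVec_transpose, hnormal,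
      Matrix.mulVec_transpose, ← Matrix.dotProduct_mulVec, dotProduct_comm]
  have h2 : A.mulVec v ⬝ᵥ u ≤ l2norm (A.mulVec v) * l2norm u := by
    refine abs_le_of_sq_le_sq' ?_ (mul_nonneg (l2norm_nonneg _) (l2norm_nonneg _)) |>.2
    rw [mul_pow, l2norm_sq, l2norm_sq]
    exact Finset.sum_mul_sq_le_sq_mul_sq _ _ _
  have h3 : l2norm (A.mulVec v) ≤ l2norm u := by
    rcases (l2norm_nonneg (A.mulVec v)).eq_or_lt with h0 | h0
    · rw [← h0]; exact l2norm_nonneg u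
    · rw [← h1, sq] at h2
      exact le_of_mul_le_mul_left h2 h0
  exact (h v).trans h3

theorem isUnit_det_diffMatrix_pow (m r : ℕ) : IsUnit (diffMatrix m ^ r).det := by
  rw [Matrix.det_pow, det_diffMatrix, one_pow]
  exact isUnit_one

/-- The reconstruction error is `(D⁻ʳ Φ)† u`. -/
theorem l2norm_sub_sobolevDual_le {m k r : ℕ} {Φ : Matrix (Fin m) (Fin k) ℝ} {s : ℝ} (hs : 0 < s)
    (h : ∀ x : Fin k → ℝ, s * l2norm x ≤ l2norm (((diffMatrix m ^ r)⁻¹ * Φ).mulVec x))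
    {x : Fin k → ℝ} {q u : Fin m → ℝ}
    (hq : Φ.mulVec x - q = (diffMatrix m ^ r).mulVec u) :
    s * l2norm (x - (sobolevDual r Φ).mulVec q) ≤ Real.sqrt m * ‖u‖ := by
  obtain ⟨hleft, hbound⟩ := canonicalDual_of_lowerBound hs h
  have hu : u = ((diffMatrix m ^ r)⁻¹ * Φ).mulVec x - (diffMatrix m ^ r)⁻¹.mulVec q := by
    rw [← Matrix.mulVec_mulVec, ← Matrix.mulVec_sub, hq, Matrix.mulVec_mulVec,
      Matrix.nonsing_inv_mul _ (isUnit_det_diffMatrix_pow m r), Matrix.one_mulVec]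
  have hx : x - (sobolevDual r Φ).mulVec q
      = (canonicalDual ((diffMatrix m ^ r)⁻¹ * Φ)).mulVec u := by
    rw [hu, Matrix.mulVec_sub, Matrix.mulVec_mulVec, hleft, Matrix.one_mulVec,
      Matrix.mulVec_mulVec]
    rfl
  rw [hx]
  exact (hbound u).trans (l2norm_le_sqrt_mul_norm u)

/-! ### Lower bound for the compressed random matrix -/

/-- The scale of the net used for sub-Gaussian parameter `κ`, tied to the typical operator norm
`√(12 K l)` of an `l × k` matrix. -/
noncomputable def netScale (κ : ℝ) : ℝ := 1 / (8 * (Real.sqrt (12 * varianceProxy κ) + 1))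

theorem netScale_pos (κ : ℝ) : 0 < netScale κ := by unfold netScale; positivity

/-- The smallest singular value of the random `l × k` matrix `w Φ` is at least `√l / 4`, outside an
event whose probability is exponentially small in `l` up to the size of a net of the sphere of
`ℝᵏ`. Disjointness of the supports of the rows of `w` makes the rows of `w Φ` independent. -/
theorem measureReal_compression_lowerBound {m k l : ℕ} {κ : ℝ} (hκ : 0 < κ) {Ω : Type*}
    [MeasurableSpace Ω] {P : Measure Ω} [IsProbabilityMeasure P]
    {Φ : Ω → Matrix (Fin m) (Fin k) ℝ}
    (hmeas : ∀ i j, Measurable fun ω => Φ ω i j)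
    (hind : iIndepFun (fun (p : Fin m × Fin k) (ω : Ω) => Φ ω p.1 p.2) P)
    (h0 : ∀ i j, ∫ ω, Φ ω i j ∂P = 0)
    (h1 : ∀ i j, variance (fun ω => Φ ω i j) P = 1)
    (hsub : ∀ i j, IsSubGaussianWith (fun ω => Φ ω i j) κ P)
    {w : Fin l → Fin m → ℝ} {idx : Fin m → ℕ} (hidx : ∀ b i, w b i ≠ 0 → idx i = b)
    (hw : ∀ b, ∑ i, w b i ^ 2 = 1) :
    1 - (1 + 2 / netScale κ) ^ k *
        (Real.exp (-(l / (4 * fourthMomentBound κ))) + Real.exp (-l)) ≤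
      P.real {ω | ∀ x : Fin k → ℝ,
        (l : ℝ) / 16 * l2norm x ^ 2 ≤ ∑ b, (∑ i, w b i * (Φ ω).mulVec x i) ^ 2} := by
  classical
  set β : ℝ := Real.sqrt (12 * varianceProxy κ) + 1 with hβ
  have hβ1 : 1 ≤ β := by have := Real.sqrt_nonneg (12 * (varianceProxy κ : ℝ)); linarith
  have hε : netScale κ = 1 / (8 * β) := rfl
  obtain ⟨N, hN1, hnet, hcard⟩ :=
    exists_sphere_net (E := EuclideanSpace ℝ (Fin k)) (netScale_pos κ)
  rw [finrank_euclideanSpace_fin] at hcard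
  let Q : EuclideanSpace ℝ (Fin k) → Ω → ℝ := fun x ω =>
    ∑ b, (∑ p : Fin m × Fin k, w b p.1 * x p.2 * Φ ω p.1 p.2) ^ 2
  have hQ : ∀ (x : EuclideanSpace ℝ (Fin k)) ω,
      Q x ω = ∑ b, (∑ i, w b i * (Φ ω).mulVec x i) ^ 2 := by
    intro x ω
    refine Finset.sum_congr rfl fun b _ => ?_
    rw [Fintype.sum_prod_type]
    congr 1
    refine Finset.sum_congr rfl fun i _ => ?_
    simp only [Matrix.mulVec, dotProduct, Finset.mul_sum]
    exact Finset.sum_congr rfl fun j _ => by ring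
  have hcoef : ∀ x ∈ N, ∀ b, ∑ p : Fin m × Fin k, (w b p.1 * x p.2) ^ 2 = 1 := by
    intro x hx b
    have hx1 : ∑ j, x j ^ 2 = 1 := by
      rw [← EuclideanSpace.real_norm_sq_eq, hN1 x hx, one_pow]
    simp only [mul_pow]
    rw [Fintype.sum_prod_type]
    simp only [← Finset.mul_sum, hx1, mul_one, hw]
  let bad : EuclideanSpace ℝ (Fin k) → Set Ω := fun x =>
    {ω | Q x ω ≤ (l : ℝ) / 4} ∪ {ω | 12 * varianceProxy κ * (l : ℝ) ≤ Q x ω}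
  have hbad : ∀ x ∈ N, P.real (bad x) ≤
      Real.exp (-(l / (4 * fourthMomentBound κ))) + Real.exp (-l) := by
    intro x hx
    refine (measureReal_union_le _ _).trans (add_le_add ?_ ?_)
    · exact measureReal_sum_sq_le (X := fun (p : Fin m × Fin k) ω => Φ ω p.1 p.2)
        (idx := fun p => idx p.1) (a := fun b p => w b p.1 * x p.2)
        (fun p => hmeas _ _) hind (fun p => h0 _ _) (fun p => h1 _ _) (fun p => hsub _ _)
        (fun b p hne => hidx b p.1 (left_ne_zero_of_mul hne)) (hcoef x hx)
    · exact measureReal_le_sum_sq (X := fun (p : Fin m × Fin k) ω => Φ ω p.1 p.2)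
        (idx := fun p => idx p.1) (a := fun b p => w b p.1 * x p.2) hκ
        (fun p => hmeas _ _) hind (fun p => h0 _ _) (fun p => hsub _ _)
        (fun b p hne => hidx b p.1 (left_ne_zero_of_mul hne)) (hcoef x hx)
  set good := {ω | ∀ x : Fin k → ℝ,
    (l : ℝ) / 16 * l2norm x ^ 2 ≤ ∑ b, (∑ i, w b i * (Φ ω).mulVec x i) ^ 2} with hgood
  have hcover : (Set.univ : Set Ω) ⊆ good ∪ ⋃ x ∈ N, bad x := by
    intro ω _
    by_cases hω : ω ∈ ⋃ x ∈ N, bad x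
    · exact Or.inr hω
    left
    simp only [Set.mem_iUnion, not_exists] at hω
    have hω' : ∀ x ∈ N, (l : ℝ) / 4 < Q x ω ∧ Q x ω < 12 * varianceProxy κ * l := by
      intro x hx
      have := hω x hx
      simp only [bad, Set.mem_union, not_or] at this
      exact ⟨not_le.1 this.1, not_le.1 this.2⟩
    -- Off the bad event the net controls the operator `w Φ` from both sides.
    let G : Matrix (Fin l) (Fin k) ℝ := Matrix.of w * Φ ω
    let T := (Matrix.toEuclideanLin G).toContinuousLinearMap
    have hT : ∀ x : EuclideanSpace ℝ (Fin k), ‖T x‖ ^ 2 = Q x ω := by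
      intro x
      rw [hQ, EuclideanSpace.real_norm_sq_eq]
      refine Finset.sum_congr rfl fun b _ => ?_
      have : (T x) b = (G.mulVec x) b := rfl
      rw [this, ← Matrix.mulVec_mulVec]
      rfl
    have hl : (0 : ℝ) ≤ l := Nat.cast_nonneg l
    have hlow : ∀ c ∈ N, Real.sqrt l / 2 ≤ ‖T c‖ := by
      intro c hc
      refine abs_le_of_sq_le_sq' ?_ (norm_nonneg _) |>.2
      rw [hT, div_pow, Real.sq_sqrt hl]
      have := (hω' c hc).1
      linarith
    have hup : ∀ c ∈ N, ‖T c‖ ≤ β * Real.sqrt l := by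
      intro c hc
      refine abs_le_of_sq_le_sq' ?_ (by positivity) |>.2
      rw [hT, mul_pow, Real.sq_sqrt hl]
      have h12 : (12 * varianceProxy κ : ℝ) ≤ β ^ 2 := by
        have h1 := Real.sq_sqrt (by positivity : (0 : ℝ) ≤ 12 * varianceProxy κ)
        have h2 := Real.sqrt_nonneg (12 * (varianceProxy κ : ℝ))
        rw [hβ]
        nlinarith
      have := (hω' c hc).2
      have := mul_le_mul_of_nonneg_right h12 hl
      linarith
    have hε2 : netScale κ ≤ 1 / 2 := by
      rw [hε]
      exact one_div_le_one_div_of_le (by norm_num) (by linarith)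
    intro x
    have hmain := lower_bound_of_net T (netScale_pos κ).le hε2 (by positivity) N hnet hlow hup
      (WithLp.toLp 2 x)
    have hconst : Real.sqrt l / 2 - 2 * (β * Real.sqrt l) * netScale κ = Real.sqrt l / 4 := by
      rw [hε]; field_simp; ring
    rw [hconst] at hmain
    have hsq := pow_le_pow_left₀ (by positivity) hmain 2
    rw [hT, hQ, mul_pow, div_pow, Real.sq_sqrt hl] at hsq
    norm_num at hsq
    exact hsq
  -- Subadditivity of the outer measure suffices, so `good` need not be measurable.
  have hP : 1 ≤ P.real good + P.real (⋃ x ∈ N, bad x) := by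
    rw [← probReal_univ (μ := P)]
    exact (measureReal_mono hcover).trans (measureReal_union_le _ _)
  have hU : P.real (⋃ x ∈ N, bad x) ≤ (1 + 2 / netScale κ) ^ k *
      (Real.exp (-(l / (4 * fourthMomentBound κ))) + Real.exp (-l)) := by
    refine (measureReal_biUnion_finset_le _ _).trans ?_
    refine (Finset.sum_le_card_nsmul _ _ _ hbad).trans ?_
    rw [nsmul_eq_mul]
    exact mul_le_mul_of_nonneg_right hcard (by positivity)
  linarith

/-! ### Choice of parameters and conclusion -/

/-- Choice of the B-spline scale `h ≈ A λ ^ α` and of the number `l ≈ m / ((r + 1) h)` of blocks.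
The constant `A = 32 (r + 1)² 4 ^ r` makes the resulting lower bound for the smallest singular value
have constant one. -/
theorem exists_block_parameters {r : ℕ} (hr : 1 ≤ r) {m : ℕ} {lam α A : ℝ}
    (hA : A = 32 * (r + 1) * (4 ^ r * (r + 1))) (hlam : 1 ≤ lam) (hα : 0 < α)
    (hμ : 2 * A * (r + 1) ≤ m * lam ^ (-α)) :
    ∃ h l : ℕ, 0 < h ∧ l * ((r + 1) * h) ≤ m ∧
      lam ^ (α * (2 * r - 1)) * m * (4 ^ r * (r + 1)) ≤ (h : ℝ) ^ (2 * r) * (l / 16) ∧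
      m * lam ^ (-α) ≤ 4 * A * (r + 1) * l := by
  have hlam0 : 0 < lam := by linarith
  set L : ℝ := lam ^ α with hL
  have hL1 : 1 ≤ L := Real.one_le_rpow hlam hα.le
  have hL0 : 0 < L := by linarith
  have hLinv : lam ^ (-α) = L⁻¹ := Real.rpow_neg hlam0.le α
  have hr0 : (0 : ℝ) ≤ r := Nat.cast_nonneg r
  have h4 : (1 : ℝ) ≤ 4 ^ r := one_le_pow₀ (by norm_num)
  have hA1 : 1 ≤ A := by
    rw [hA]
    nlinarith [mul_nonneg hr0 hr0]
  have hA0 : 0 < A := by linarith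
  have hAL : 1 ≤ A * L := one_le_mul_of_one_le_of_one_le hA1 hL1
  set h : ℕ := ⌈A * L⌉₊ with hh
  have hle : A * L ≤ h := Nat.le_ceil _
  have hge : (h : ℝ) ≤ 2 * (A * L) := by
    have := Nat.ceil_lt_add_one (by linarith : 0 ≤ A * L)
    rw [← hh] at this
    linarith
  have hhpos : (0 : ℝ) < h := by linarith
  have hhpos' : 0 < h := by exact_mod_cast hhpos
  rw [hLinv, ← div_eq_mul_inv] at hμ ⊢
  rw [le_div_iff₀ hL0] at hμ
  set n : ℕ := (r + 1) * h with hn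
  have hncast : (n : ℝ) = (r + 1) * h := by rw [hn]; push_cast; ring
  have hnpos : 0 < n := Nat.mul_pos (by omega) hhpos'
  have hnm : n ≤ m := by
    have : (n : ℝ) ≤ m := by
      rw [hncast]
      nlinarith
    exact_mod_cast this
  set l : ℕ := m / n with hl
  have hl1 : 1 ≤ l := (Nat.one_le_div_iff hnpos).2 hnm
  have hml : (m : ℝ) ≤ 2 * ((r + 1) * h) * l := by
    have h1 : m < (l + 1) * n := by
      have := Nat.lt_mul_div_succ m hnpos
      rw [mul_comm]; exact this
    have h2 : m ≤ 2 * n * l := by nlinarith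
    have h3 : (m : ℝ) ≤ 2 * n * l := by exact_mod_cast h2
    rwa [hncast] at h3
  refine ⟨h, l, hhpos', Nat.div_mul_le_self m n, ?_, ?_⟩
  · obtain ⟨s, rfl⟩ : ∃ s, r = s + 1 := ⟨r - 1, by omega⟩
    have hpow : lam ^ (α * (2 * ((s + 1 : ℕ) : ℝ) - 1)) = L ^ (2 * s + 1) := by
      rw [hL, ← Real.rpow_natCast, ← Real.rpow_mul hlam0.le]
      congr 1
      push_cast
      ring
    have hhL : A * L ^ (2 * s + 1) ≤ (h : ℝ) ^ (2 * s + 1) := by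
      calc A * L ^ (2 * s + 1) ≤ A ^ (2 * s + 1) * L ^ (2 * s + 1) := by
            gcongr
            exact le_self_pow₀ hA1 (by omega)
        _ = (A * L) ^ (2 * s + 1) := (mul_pow _ _ _).symm
        _ ≤ _ := by gcongr
    rw [hpow]
    set c : ℝ := 4 ^ (s + 1) * (((s + 1 : ℕ) : ℝ) + 1) with hc
    have hc0 : 0 < c := by positivity
    set t : ℝ := ((s + 1 : ℕ) : ℝ) + 1 with ht
    have ht0 : 0 < t := by positivity
    calc L ^ (2 * s + 1) * m * c ≤ L ^ (2 * s + 1) * (2 * (t * h) * l) * c := by gcongr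
      _ = (32 * t * c * L ^ (2 * s + 1)) * (h * (l / 16)) := by ring
      _ = (A * L ^ (2 * s + 1)) * (h * (l / 16)) := by rw [hA]
      _ ≤ h ^ (2 * s + 1) * (h * (l / 16)) := by gcongr
      _ = (h : ℝ) ^ (2 * (s + 1)) * (l / 16) := by ring
  · rw [div_le_iff₀ hL0]
    calc (m : ℝ) ≤ 2 * ((r + 1) * h) * l := hml
      _ ≤ 2 * ((r + 1) * (2 * (A * L))) * l := by gcongr
      _ = _ := by ring

/-- The failure probability of the net argument is exponentially small in `μ = m λ ^ (-α)` once
`μ / k` exceeds the entropy of the net. -/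
theorem net_failure_le {T K γ D c μ : ℝ} {k l : ℕ} (hT : 1 ≤ T) (hk : 0 < k)
    (hγ : γ = min (1 / (4 * K)) 1) (hγ0 : 0 < γ) (hD : 0 < D)
    (hc : 2 * D * Real.log (2 * T) / γ ≤ c) (hμ : c * k ≤ μ) (hl : μ ≤ D * l) :
    T ^ k * (Real.exp (-(l / (4 * K))) + Real.exp (-l)) ≤ Real.exp (-(γ / (2 * D)) * μ) := by
  have hl0 : (0 : ℝ) ≤ l := Nat.cast_nonneg l
  have e1 : Real.exp (-(l / (4 * K))) ≤ Real.exp (-(γ * l)) := by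
    refine Real.exp_le_exp.2 (neg_le_neg ?_)
    have : γ ≤ 1 / (4 * K) := hγ ▸ min_le_left _ _
    calc γ * l ≤ 1 / (4 * K) * l := by gcongr
      _ = _ := by ring
  have e2 : Real.exp (-(l : ℝ)) ≤ Real.exp (-(γ * l)) := by
    refine Real.exp_le_exp.2 (neg_le_neg ?_)
    have : γ ≤ 1 := hγ ▸ min_le_right _ _
    nlinarith
  have hkey : k * Real.log (2 * T) ≤ γ / (2 * D) * μ := by
    have h1 : 2 * D * Real.log (2 * T) / γ * k ≤ μ :=
      (mul_le_mul_of_nonneg_right hc (Nat.cast_nonneg k)).trans hμ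
    calc k * Real.log (2 * T) = γ / (2 * D) * (2 * D * Real.log (2 * T) / γ * k) := by
          field_simp
      _ ≤ _ := by gcongr
  have hlμ : γ / D * μ ≤ γ * l := by
    calc γ / D * μ ≤ γ / D * (D * l) := by gcongr
      _ = _ := by field_simp
  have h2k : (2 : ℝ) ≤ 2 ^ k := le_self_pow₀ one_le_two hk.ne'
  calc T ^ k * (Real.exp (-(l / (4 * K))) + Real.exp (-l))
      ≤ T ^ k * (2 * Real.exp (-(γ * l))) := by
        have : 0 < T ^ k := by positivity
        nlinarith
    _ ≤ T ^ k * (2 ^ k * Real.exp (-(γ * l))) := by gcongr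
    _ = Real.exp (k * Real.log (2 * T)) * Real.exp (-(γ * l)) := by
        rw [Real.exp_nat_mul, Real.exp_log (by positivity), mul_pow]
        ring
    _ = Real.exp (k * Real.log (2 * T) - γ * l) := by rw [← Real.exp_add, sub_eq_add_neg]
    _ ≤ _ := by
        refine Real.exp_le_exp.2 ?_
        have : γ / D * μ = 2 * (γ / (2 * D) * μ) := by field_simp
        linarith

/-- A lower bound for the compression `w Φ` along smooth test vectors transfers to `D⁻ʳ Φ`. -/
theorem le_l2norm_inv_pow_mul_mulVec {r m k l h : ℕ} {Φ : Matrix (Fin m) (Fin k) ℝ} {s : ℝ}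
    {w : Fin l → Fin m → ℝ}
    (hw : ∀ z : Fin m → ℝ,
      (h : ℝ) ^ (2 * r) * ∑ b, (∑ i, w b i * (diffMatrix m ^ r).mulVec z i) ^ 2 ≤
        4 ^ r * (r + 1) * ∑ i, z i ^ 2)
    (hs : s ^ 2 * (4 ^ r * (r + 1)) ≤ (h : ℝ) ^ (2 * r) * (l / 16)) (x : Fin k → ℝ)
    (hx : (l : ℝ) / 16 * l2norm x ^ 2 ≤ ∑ b, (∑ i, w b i * Φ.mulVec x i) ^ 2) :
    s * l2norm x ≤ l2norm (((diffMatrix m ^ r)⁻¹ * Φ).mulVec x) := by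
  set z := ((diffMatrix m ^ r)⁻¹ * Φ).mulVec x with hz
  have hDz : (diffMatrix m ^ r).mulVec z = Φ.mulVec x := by
    rw [hz, ← Matrix.mulVec_mulVec, Matrix.mulVec_mulVec,
      Matrix.mul_nonsing_inv _ (isUnit_det_diffMatrix_pow m r), Matrix.one_mulVec]
  have h1 := hw z
  rw [hDz, ← l2norm_sq z] at h1
  refine abs_le_of_sq_le_sq' ?_ (l2norm_nonneg _) |>.2
  have hC : (0 : ℝ) < 4 ^ r * (r + 1) := by positivity
  refine le_of_mul_le_mul_left ?_ hC
  calc 4 ^ r * (r + 1) * (s * l2norm x) ^ 2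
      = s ^ 2 * (4 ^ r * (r + 1)) * l2norm x ^ 2 := by ring
    _ ≤ (h : ℝ) ^ (2 * r) * (l / 16) * l2norm x ^ 2 := by gcongr
    _ = (h : ℝ) ^ (2 * r) * (l / 16 * l2norm x ^ 2) := by ring
    _ ≤ (h : ℝ) ^ (2 * r) * ∑ b, (∑ i, w b i * Φ.mulVec x i) ^ 2 := by gcongr
    _ ≤ _ := h1

/-- Smallest singular value of `D⁻ʳ Φ` for sub-Gaussian random frames, and the resulting error bound
for Sobolev-dual reconstruction. Here `‖u‖` for `u : Fin m → ℝ` is the sup norm. -/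
theorem mainTheorem2 (r : ℕ) (hr : 1 ≤ r) :
    ∃ C : ℝ, 0 < C ∧ ∀ κ : ℝ, 0 < κ →
      ∃ c c' : ℝ, 0 < c ∧ 0 < c' ∧
        ∀ (α : ℝ), 0 < α → α < 1 →
        ∀ (m k : ℕ), 0 < k →
        ∀ {Ω : Type*} [MeasurableSpace Ω] (P : Measure Ω) [IsProbabilityMeasure P]
          (Φ : Ω → Matrix (Fin m) (Fin k) ℝ),
          (∀ i j, Measurable fun ω => Φ ω i j) →
          iIndepFun (fun (p : Fin m × Fin k) (ω : Ω) => Φ ω p.1 p.2) P →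
          (∀ i j, ∫ ω, Φ ω i j ∂P = 0) →
          (∀ i j, variance (fun ω => Φ ω i j) P = 1) →
          (∀ i j, IsSubGaussianWith (fun ω => Φ ω i j) κ P) →
          ∀ lam : ℝ, lam = (m : ℝ) / (k : ℝ) → c ^ (1 / (1 - α)) ≤ lam →
            1 - Real.exp (-c' * (m : ℝ) * lam ^ (-α)) ≤
              P.real {ω |
                lam ^ (α * ((r : ℝ) - 1 / 2)) * Real.sqrt (m : ℝ)
                    ≤ sigmaMin ((diffMatrix m ^ r)⁻¹ * Φ ω) ∧
                ∀ (x : Fin k → ℝ) (q u : Fin m → ℝ),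
                  (Φ ω).mulVec x - q = (diffMatrix m ^ r).mulVec u →
                  l2norm (x - (sobolevDual r (Φ ω)).mulVec q)
                    ≤ C * lam ^ (-(α * ((r : ℝ) - 1 / 2))) * ‖u‖} := by
  refine ⟨1, one_pos, fun κ hκ => ?_⟩
  set A : ℝ := 32 * (r + 1) * (4 ^ r * (r + 1)) with hA
  set D : ℝ := 4 * A * (r + 1) with hD
  have hD0 : 0 < D := by positivity
  set T : ℝ := 1 + 2 / netScale κ with hT
  have hT1 : 1 ≤ T := by
    have := netScale_pos κ
    have : 0 < 2 / netScale κ := by positivity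
    linarith
  set γ : ℝ := min (1 / (4 * fourthMomentBound κ)) 1 with hγ
  have hγ0 : 0 < γ := lt_min (by have := fourthMomentBound_pos κ; positivity) one_pos
  have hlog : 0 ≤ 2 * D * Real.log (2 * T) / γ := by
    have : 0 ≤ Real.log (2 * T) := Real.log_nonneg (by linarith)
    positivity
  refine ⟨1 + D + 2 * D * Real.log (2 * T) / γ, γ / (2 * D), by positivity, by positivity, ?_⟩
  intro α hα0 hα1 m k hk Ω _ P _ Φ hmeas hind h0 h1 hsub lam hlam hc
  set c : ℝ := 1 + D + 2 * D * Real.log (2 * T) / γ with hcdef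
  have hα : 0 < 1 - α := by linarith
  have hlam1 : 1 ≤ lam := (Real.one_le_rpow (by linarith) (by positivity)).trans hc
  have hlam0 : 0 < lam := by linarith
  have hk' : (1 : ℝ) ≤ k := by exact_mod_cast hk
  have hm : (m : ℝ) = lam * k := by rw [hlam]; field_simp
  have hcle : c ≤ lam ^ (1 - α) := by
    have h2 := Real.rpow_le_rpow (by positivity) hc hα.le
    rwa [← Real.rpow_mul (by linarith), one_div_mul_cancel hα.ne', Real.rpow_one] at h2
  have hμ : c * k ≤ m * lam ^ (-α) := by
    have : (m : ℝ) * lam ^ (-α) = lam ^ (1 - α) * k := by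
      rw [hm, sub_eq_add_neg, Real.rpow_add hlam0, Real.rpow_one]; ring
    rw [this]
    gcongr
  have hAμ : 2 * A * (r + 1) ≤ m * lam ^ (-α) := by
    have : 2 * A * ((r : ℝ) + 1) ≤ D := by
      rw [hD]
      have : 0 ≤ A * ((r : ℝ) + 1) := by positivity
      linarith
    have : c ≤ c * k := le_mul_of_one_le_right (by linarith) hk'
    linarith
  obtain ⟨h, l, hh, hhl, hsl, hll⟩ := exists_block_parameters hr hA hlam1 hα0 hAμ
  obtain ⟨w, idx, hidx, hw1, hw⟩ := exists_smooth_testVectors r hh hhl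
  have hprob := measureReal_compression_lowerBound hκ hmeas hind h0 h1 hsub hidx hw1
  have hfail := net_failure_le hT1 hk hγ hγ0 hD0
    (by linarith : 2 * D * Real.log (2 * T) / γ ≤ c) hμ hll
  rw [← mul_assoc] at hfail
  refine le_trans (by linarith) (hprob.trans (measureReal_mono ?_))
  intro ω hω
  have hmpos : (0 : ℝ) < m := by rw [hm]; positivity
  set s : ℝ := lam ^ (α * ((r : ℝ) - 1 / 2)) * Real.sqrt m with hs
  have hspos : 0 < s := by positivity
  have hs2 : s ^ 2 = lam ^ (α * (2 * r - 1)) * m := by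
    rw [hs, mul_pow, Real.sq_sqrt hmpos.le, ← Real.rpow_natCast, ← Real.rpow_mul hlam0.le]
    congr 2
    push_cast
    ring
  have hlow : ∀ x : Fin k → ℝ,
      s * l2norm x ≤ l2norm (((diffMatrix m ^ r)⁻¹ * Φ ω).mulVec x) := fun x =>
    le_l2norm_inv_pow_mul_mulVec hw (by rw [hs2]; exact hsl) x (hω x)
  refine ⟨le_sigmaMin hk hlow, fun x q u hq => ?_⟩
  have herr := l2norm_sub_sobolevDual_le hspos hlow hq
  have hsqrt : 0 < Real.sqrt m := Real.sqrt_pos.2 hmpos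
  rw [hs, mul_right_comm, mul_comm (Real.sqrt (m : ℝ))] at herr
  have herr' := le_of_mul_le_mul_right herr hsqrt
  rw [one_mul, Real.rpow_neg hlam0.le]
  exact (le_inv_mul_iff₀ (by positivity)).2 herr'
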